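/- Let $M$ be a connected smooth $n$-dimensional manifold with a smooth (pseudo-)Riemannian metric $g_{ij}$ of any signature, let $V:M\to\mathbb R$ be smooth, and consider the Klein-Gordon equation $$\Delta u=V(x)\,u,\qquad \Delta u=g^{ij}u_{,ij}-\Gamma^i u_{,i},\quad \Gamma^i=g^{jk}\Gamma^i_{jk}.$$ A smooth vector field $X=\xi^i(x,u)\,\partial_i+\eta(x,u)\,\partial_u$ on $M\times\mathbb R$ is a Lie point symmetry of this equation if, in local coordinates and with $H=g^{ij}u_{ij}-\Gamma^iu_i-Vu$ as a function of the second order jet $(x^i,u,u_i,u_{ij})$, $u_{ij}=u_{ji}$, there is a function $\lambda$ on jets such that $X^{[2]}H=\lambda H$ (that is, $X^{[2]}H=0$ wherever $H=0$). Here $$X^{[2]}=X+\eta_{[i]}\partial_{u_i}+\eta_{[ij]}\partial_{u_{ij}},\quad \eta_{[i]}=D_i\eta-u_jD_i\xi^j,\quad \eta_{[ij]}=D_j\eta_{[i]}-u_{ik}D_j\xi^k,$$ and $D_i$ is the total derivative. A vector field $\xi$ on $M$ is a conformal Killing vector (CKV) with conformal factor $\psi$ if $L_\xi g_{ij}=2\psi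 g_{ij}$. Then: (a) If $n>2$, then $X$ is a Lie point symmetry if and only if $$X=\xi^i(x)\,\partial_i+\Big(\tfrac{2-n}{2}\,\psi(x)\,u+a_0u+b(x)\Big)\partial_u,$$ where $\xi$ is a smooth CKV with smooth conformal factor $\psi$, $a_0$ is a real constant, $b$ is a smooth solution of the Klein-Gordon equation on $M$, and $$\xi^kV_{,k}+2\psi V-\tfrac{2-n}{2}\,\Delta\psi=0.$$ (b) If $n=2$, then $X$ is a Lie point symmetry if and only if $$X=\xi^i(x)\,\partial_i+\big(a_0u+b(x)\big)\partial_u,$$ where $\xi$ is a smooth CKV with smooth conformal factor $\psi$, $a_0$ is a real constant, $b$ is a smooth solution of the Klein-Gordon equation on $M$, and $$\xi^kV_{,k}+2\psi V=0.$$ -/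

import Mathlib

open scoped Manifold ContDiff

noncomputable section

namespace KleinGordon

/-! ### Local coordinates: jets, total derivatives, prolongation -/

/-- Coordinate space `ℝⁿ`. -/
abbrev Coord (n : ℕ) : Type := EuclideanSpace ℝ (Fin n)

/-- The `i`-th coordinate vector `∂_i`. -/
abbrev coordVec {n : ℕ} (i : Fin n) : Coord n := EuclideanSpace.single i (1 : ℝ)

/-- The partial derivative `f_{,i}` of a function on coordinate space. -/
def pderiv {n : ℕ} (i : Fin n) (f : Coord n → ℝ) (x : Coord n) : ℝ :=
  fderiv ℝ f x (coordVec i)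

/-- First order jets `(x^i, u, u_i)` of a scalar function of `n` variables. -/
abbrev Jet1 (n : ℕ) : Type := Coord n × ℝ × (Fin n → ℝ)

/-- Second order jets `(x^i, u, u_i, u_ij)` of a scalar function of `n` variables. The symmetry
`u_ij = u_ji` is imposed where jets are quantified over. -/
abbrev Jet2 (n : ℕ) : Type := Coord n × ℝ × (Fin n → ℝ) × (Fin n → Fin n → ℝ)

/-- The total derivative `D_i F = F_{,i} + u_i F_{,u}` of a function `F(x, u)`. -/
def totalDeriv0 {n : ℕ} (i : Fin n) (F : Coord n × ℝ → ℝ) : Jet1 n → ℝ :=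
  fun z => fderiv ℝ F (z.1, z.2.1) (coordVec i, z.2.2 i)

/-- The total derivative `D_i F = F_{,i} + u_i F_{,u} + u_ij F_{,u_j}` of a function
`F(x, u, u_k)`. -/
def totalDeriv1 {n : ℕ} (i : Fin n) (F : Jet1 n → ℝ) : Jet2 n → ℝ :=
  fun z => fderiv ℝ F (z.1, z.2.1, z.2.2.1) (coordVec i, z.2.2.1 i, z.2.2.2 i)

/-- The first prolongation coefficient `η_[i] = D_i η - u_j D_i ξ^j` of the vector field
`ξ^j(x, u) ∂_j + η(x, u) ∂_u`. -/
def prolong1 {n : ℕ} (ξ : Coord n × ℝ → Coord n) (η : Coord n × ℝ → ℝ) (i : Fin n) :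
    Jet1 n → ℝ :=
  fun z => totalDeriv0 i η z - ∑ j, z.2.2 j * totalDeriv0 i (fun y => ξ y j) z

/-- The second prolongation coefficient `η_[ij] = D_j η_[i] - u_ik D_j ξ^k`. -/
def prolong2 {n : ℕ} (ξ : Coord n × ℝ → Coord n) (η : Coord n × ℝ → ℝ) (i j : Fin n) :
    Jet2 n → ℝ :=
  fun z => totalDeriv1 j (prolong1 ξ η i) z
    - ∑ k, z.2.2.2 i k * totalDeriv0 j (fun y => ξ y k) (z.1, z.2.1, z.2.2.1)

/-- `X^[2] H`: the derivative of a function `H(x, u, u_i, u_ij)` along the second prolongation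
`ξ^i ∂_i + η ∂_u + η_[i] ∂_{u_i} + η_[ij] ∂_{u_ij}` of `X = ξ^i ∂_i + η ∂_u`. -/
def prolongedDeriv {n : ℕ} (ξ : Coord n × ℝ → Coord n) (η : Coord n × ℝ → ℝ)
    (H : Jet2 n → ℝ) : Jet2 n → ℝ :=
  fun z => fderiv ℝ H z
    (ξ (z.1, z.2.1), η (z.1, z.2.1),
      (fun i => prolong1 ξ η i (z.1, z.2.1, z.2.2.1)),
      (fun i j => prolong2 ξ η i j z))

/-! ### Local coordinates: metric, Laplace operator, Lie derivative -/

/-- The Christoffel symbols `Γ^i_jk` of a matrix-valued function `G = (g_ij)`. -/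
def christoffel {n : ℕ} (G : Coord n → Matrix (Fin n) (Fin n) ℝ) (x : Coord n)
    (i j k : Fin n) : ℝ :=
  (1 / 2) * ∑ l, (G x)⁻¹ i l *
    (pderiv j (fun y => G y l k) x + pderiv k (fun y => G y l j) x - pderiv l (fun y => G y j k) x)

/-- The Laplace operator of the metric `G = (g_ij)` as a function on jets:
`g^ij u_ij - g^jk Γ^i_jk u_i`. -/
def laplaceJet {n : ℕ} (G : Coord n → Matrix (Fin n) (Fin n) ℝ) (x : Coord n)
    (p : Fin n → ℝ) (q : Fin n → Fin n → ℝ) : ℝ :=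
  ∑ i, ∑ j, (G x)⁻¹ i j * q i j
    - ∑ i, (∑ j, ∑ k, (G x)⁻¹ j k * christoffel G x i j k) * p i

/-- `Δ f`, in coordinates, for the metric `G = (g_ij)`. -/
def laplace {n : ℕ} (G : Coord n → Matrix (Fin n) (Fin n) ℝ) (f : Coord n → ℝ)
    (x : Coord n) : ℝ :=
  laplaceJet G x (fun i => pderiv i f x) (fun i j => pderiv j (pderiv i f) x)

/-- The Klein-Gordon equation `Δ u - V u = 0`, as a function `H(x, u, u_i, u_ij)` on jets. -/
def kleinGordonJet {n : ℕ} (G : Coord n → Matrix (Fin n) (Fin n) ℝ) (V : Coord n → ℝ) :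
    Jet2 n → ℝ :=
  fun z => laplaceJet G z.1 z.2.2.1 z.2.2.2 - V z.1 * z.2.1

/-- The components `(L_ξ g)_ij = ξ^k g_ij,k + g_kj ξ^k_,i + g_ik ξ^k_,j` of the Lie derivative
of the metric `G = (g_ij)`. -/
def lieDerivMetric {n : ℕ} (G : Coord n → Matrix (Fin n) (Fin n) ℝ) (ξ : Coord n → Coord n)
    (x : Coord n) (i j : Fin n) : ℝ :=
  ∑ k, (ξ x k * pderiv k (fun y => G y i j) x
    + G x k j * pderiv i (fun y => ξ y k) x
    + G x i k * pderiv j (fun y => ξ y k) x)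

/-! ### Pseudo-Riemannian manifolds -/

/-- A smooth pseudo-Riemannian metric (of any signature) on an `n`-dimensional manifold. -/
structure PseudoRiemannianMetric (n : ℕ) (M : Type*) [TopologicalSpace M]
    [ChartedSpace (EuclideanSpace ℝ (Fin n)) M] [IsManifold (𝓡 n) ∞ M] where
  /-- the bilinear form on each tangent space -/
  inner (p : M) : TangentSpace (𝓡 n) p →L[ℝ] TangentSpace (𝓡 n) p →L[ℝ] ℝ
  symm (p : M) (v w : TangentSpace (𝓡 n) p) : inner p v w = inner p w v
  nondegenerate (p : M) (v : TangentSpace (𝓡 n) p) : (∀ w, inner p v w = 0) → v = 0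
  contMDiff : ContMDiff (𝓡 n)
    ((𝓡 n).prod 𝓘(ℝ, EuclideanSpace ℝ (Fin n) →L[ℝ] EuclideanSpace ℝ (Fin n) →L[ℝ] ℝ)) ∞
    (fun p => Bundle.TotalSpace.mk'
      (EuclideanSpace ℝ (Fin n) →L[ℝ] EuclideanSpace ℝ (Fin n) →L[ℝ] ℝ) p (inner p))

section Manifold

variable {n : ℕ} {M : Type*} [TopologicalSpace M] [ChartedSpace (EuclideanSpace ℝ (Fin n)) M]

/-- The components at the point `p` of the tangent vector `v`, in the chart `e`. -/
def vecInChart (e : OpenPartialHomeomorph M (EuclideanSpace ℝ (Fin n))) (p : M)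
    (v : TangentSpace (𝓡 n) p) : Coord n :=
  mfderiv (𝓡 n) (𝓡 n) e p v

/-- The tangent vector `∂_i` of the manifold, at the point with coordinates `x` in the
chart `e`. -/
def chartVec (e : OpenPartialHomeomorph M (EuclideanSpace ℝ (Fin n))) (x : Coord n)
    (i : Fin n) : TangentSpace (𝓡 n) (e.symm x) :=
  mfderiv (𝓡 n) (𝓡 n) e.symm x (coordVec i)

/-- Smoothness of a tangent vector field. -/
def IsSmoothVectorField [IsManifold (𝓡 n) ∞ M] (ξ : ∀ p : M, TangentSpace (𝓡 n) p) : Prop :=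
  ContMDiff (𝓡 n) (𝓡 n).tangent ∞ (fun p => (⟨p, ξ p⟩ : TangentBundle (𝓡 n) M))

variable [IsManifold (𝓡 n) ∞ M]

/-- The components `g_ij` of the metric in the chart `e`. -/
def PseudoRiemannianMetric.inChart (g : PseudoRiemannianMetric n M)
    (e : OpenPartialHomeomorph M (EuclideanSpace ℝ (Fin n))) (x : Coord n) :
    Matrix (Fin n) (Fin n) ℝ :=
  Matrix.of fun i j => g.inner (e.symm x) (chartVec e x i) (chartVec e x j)

/-- `ξ` is a conformal Killing vector field of `g` with conformal factor `ψ`: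
`L_ξ g = 2 ψ g`. -/
def IsConformalKilling (g : PseudoRiemannianMetric n M) (ξ : ∀ p : M, TangentSpace (𝓡 n) p)
    (ψ : M → ℝ) : Prop :=
  IsSmoothVectorField ξ ∧ ContMDiff (𝓡 n) 𝓘(ℝ, ℝ) ∞ ψ ∧
    ∀ e ∈ IsManifold.maximalAtlas (𝓡 n) ∞ M, ∀ x ∈ e.target, ∀ i j : Fin n,
      lieDerivMetric (g.inChart e) (fun y => vecInChart e (e.symm y) (ξ (e.symm y))) x i j
        = 2 * ψ (e.symm x) * g.inChart e x i j

/-- `b` is a (smooth, globally defined) solution of the Klein-Gordon equation `Δ b = V b`. -/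
def IsSolution (g : PseudoRiemannianMetric n M) (V b : M → ℝ) : Prop :=
  ContMDiff (𝓡 n) 𝓘(ℝ, ℝ) ∞ b ∧
    ∀ e ∈ IsManifold.maximalAtlas (𝓡 n) ∞ M, ∀ x ∈ e.target,
      laplace (g.inChart e) (fun y => b (e.symm y)) x = V (e.symm x) * b (e.symm x)

/-- The condition `ξ^k V_,k + 2 ψ V - c Δψ = 0`, at every point and in all charts. -/
def PotentialCondition (g : PseudoRiemannianMetric n M) (V : M → ℝ)
    (ξ : ∀ p : M, TangentSpace (𝓡 n) p) (ψ : M → ℝ) (c : ℝ) : Prop :=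
  ∀ e ∈ IsManifold.maximalAtlas (𝓡 n) ∞ M, ∀ x ∈ e.target,
    ∑ k, vecInChart e (e.symm x) (ξ (e.symm x)) k * pderiv k (fun y => V (e.symm y)) x
      + 2 * ψ (e.symm x) * V (e.symm x)
      - c * laplace (g.inChart e) (fun y => ψ (e.symm y)) x = 0

variable (n M) in
/-- A smooth vector field `X = ξ^i(x, u) ∂_i + η(x, u) ∂_u` on `M × ℝ`, the space of the
independent variables `x` and the dependent variable `u`. -/
structure PointVectorField where
  /-- the component along `M` -/
  ξ (p : M) (u : ℝ) : TangentSpace (𝓡 n) p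
  /-- the component along `∂_u` -/
  η (p : M) (u : ℝ) : ℝ
  smooth_ξ : ContMDiff ((𝓡 n).prod 𝓘(ℝ, ℝ)) (𝓡 n).tangent ∞
    (fun z : M × ℝ => (⟨z.1, ξ z.1 z.2⟩ : TangentBundle (𝓡 n) M))
  smooth_η : ContMDiff ((𝓡 n).prod 𝓘(ℝ, ℝ)) 𝓘(ℝ, ℝ) ∞ (fun z : M × ℝ => η z.1 z.2)

/-- `X` is (the generator of) a Lie point symmetry of the Klein-Gordon equation `Δ u = V u`:
in every chart, with `H = Δ u - V u` as a function on second order jets, there is a function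
`μ` on jets with `X^[2] H = μ H`. As `μ` is an arbitrary function, this says exactly that
`X^[2] H` vanishes wherever `H = 0`. -/
def IsLieSymmetry (g : PseudoRiemannianMetric n M) (V : M → ℝ) (X : PointVectorField n M) :
    Prop :=
  ∀ e ∈ IsManifold.maximalAtlas (𝓡 n) ∞ M, ∃ μ : Jet2 n → ℝ,
    ∀ x ∈ e.target, ∀ (u : ℝ) (p : Fin n → ℝ) (q : Fin n → Fin n → ℝ),
      (∀ i j, q i j = q j i) →
        prolongedDeriv
            (fun z => vecInChart e (e.symm z.1) (X.ξ (e.symm z.1) z.2))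
            (fun z => X.η (e.symm z.1) z.2)
            (kleinGordonJet (g.inChart e) (fun y => V (e.symm y))) (x, u, p, q)
          = μ (x, u, p, q)
            * kleinGordonJet (g.inChart e) (fun y => V (e.symm y)) (x, u, p, q)

end Manifold

end KleinGordon

end

open scoped Manifold ContDiff

noncomputable section

namespace KleinGordon

section

variable {n : ℕ}

/-! For fixed x, u, u_i the function X^[2]H is affine in the symmetric matrix u_ij, and H = 0 is an
affine hyperplane of such matrices with normal g^ij. Vanishing on it forces the linear part of
X^[2]H to be μ g^ij and the value at u_ij = 0 to be the matching multiple (`prolongedDeriv_affine`,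
`exists_multiplier`, `exists_symmetry_multiplier`). The rest is read off by varying u_i. In the
linear part, a suitable choice of u_i gives ξ^a_,u ξ^b_,u = ν g^ab. An invertible matrix of size at
least two has rank greater than one, so ξ_,u = 0 (`du_field_eq_zero`), and what remains of the
linear part says that ξ is a conformal Killing vector. Now μ no longer depends on u_i, so the
quadratic term η_,uu g^ij u_i u_j at u_ij = 0 must vanish and η = a(x) u + b(x) (`du_du_eq_zero`).

For fields of this shape `prolongedDeriv_of_conformalKilling` gives X^[2]H = (a - 2ψ) H + g^ij (2
a_,j - (2-n) ψ_,j) u_i + u (Δa - ξ^k V_,k - 2ψV) + (Δb - Vb), which serves both directions of the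
equivalence. Its core is `fderiv_gam`, the derivative of Γ^i along ξ. This follows from Γ^i =
-g^ik_,k - g^il (log √|g|)_,l (`gam_eq`) by differentiating the conformal Killing equation and its
trace. On H = 0 the remaining terms vanish separately (`determining_equations`).

Globally, ψ does not depend on the chart because L_ξ g is a tensor (`lieDerivMetric_transform`), and
a - (2-n)/2 ψ has zero gradient, hence is a constant a₀ by connectedness. For n = 2 the coefficient
(2-n)/2 is zero, so both cases are instances of one equivalence. -/

/-- `f` is differentiable at `z`, with derivative `d` in the direction `v`. -/
structure HasDirDeriv {E : Type*} [NormedAddCommGroup E] [NormedSpace ℝ E] (f : E → ℝ) (z v : E)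
    (d : ℝ) : Prop where
  diff : DifferentiableAt ℝ f z
  eq : fderiv ℝ f z v = d

/-! ### Calculus rules for directional derivatives. -/

section
variable {E : Type*} [NormedAddCommGroup E] [NormedSpace ℝ E] {f g : E → ℝ} {z v : E} {a b : ℝ}

theorem HasDirDeriv.add (hf : HasDirDeriv f z v a) (hg : HasDirDeriv g z v b) :
    HasDirDeriv (fun y => f y + g y) z v (a + b) :=
  ⟨hf.diff.add hg.diff, by rw [fderiv_fun_add hf.diff hg.diff]; simp [hf.eq, hg.eq]⟩

theorem HasDirDeriv.sub (hf : HasDirDeriv f z v a) (hg : HasDirDeriv g z v b) :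
    HasDirDeriv (fun y => f y - g y) z v (a - b) :=
  ⟨hf.diff.sub hg.diff, by rw [fderiv_fun_sub hf.diff hg.diff]; simp [hf.eq, hg.eq]⟩

theorem HasDirDeriv.mul (hf : HasDirDeriv f z v a) (hg : HasDirDeriv g z v b) :
    HasDirDeriv (fun y => f y * g y) z v (a * g z + f z * b) :=
  ⟨hf.diff.mul hg.diff, by
    rw [fderiv_fun_mul hf.diff hg.diff]; simp [hf.eq, hg.eq]; ring⟩

theorem HasDirDeriv.const_mul (c : ℝ) (hf : HasDirDeriv f z v a) :
    HasDirDeriv (fun y => c * f y) z v (c * a) :=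
  ⟨hf.diff.const_mul c, by rw [fderiv_const_mul hf.diff]; simp [hf.eq]⟩

theorem HasDirDeriv.neg (hf : HasDirDeriv f z v a) :
    HasDirDeriv (fun y => - f y) z v (-a) :=
  ⟨hf.diff.neg, by rw [fderiv_fun_neg]; simp [hf.eq]⟩

theorem HasDirDeriv.sum {ι : Type*} {s : Finset ι} {f : ι → E → ℝ} {a : ι → ℝ}
    (hf : ∀ i ∈ s, HasDirDeriv (f i) z v (a i)) :
    HasDirDeriv (fun y => ∑ i ∈ s, f i y) z v (∑ i ∈ s, a i) :=
  ⟨DifferentiableAt.fun_sum fun i hi => (hf i hi).diff, by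
    rw [fderiv_fun_sum fun i hi => (hf i hi).diff]
    simp only [FunLike.coe_sum, Finset.sum_apply]
    exact Finset.sum_congr rfl fun i hi => (hf i hi).eq⟩

theorem HasDirDeriv.clm (L : E →L[ℝ] ℝ) : HasDirDeriv (fun y => L y) z v (L v) :=
  ⟨L.differentiableAt, by rw [L.fderiv]⟩

theorem _root_.DifferentiableAt.hasDirDeriv (hf : DifferentiableAt ℝ f z) (v : E) :
    HasDirDeriv f z v (fderiv ℝ f z v) := ⟨hf, rfl⟩

/-- Jet coordinates are continuous linear projections, so this is the chain rule that jet space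
requires. -/
theorem HasDirDeriv.comp_clm {F : Type*} [NormedAddCommGroup F] [NormedSpace ℝ F] (L : E →L[ℝ] F)
    {h : F → ℝ} (hh : HasDirDeriv h (L z) (L v) a) : HasDirDeriv (fun y => h (L y)) z v a :=
  ⟨DifferentiableAt.comp z hh.diff L.differentiableAt, by
    have := fderiv_comp (𝕜 := ℝ) z hh.diff L.differentiableAt
    rw [← hh.eq]
    erw [this]
    simp [L.fderiv]⟩

theorem HasDirDeriv.congr_eq (hf : HasDirDeriv f z v a) (h : a = b) : HasDirDeriv f z v b := h ▸ hf

end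

/-! ### Partial derivatives -/

/-- The partial derivative `F_{,i}` of a function `F(x, u)`. -/
def dx (i : Fin n) (F : Coord n × ℝ → ℝ) (y : Coord n × ℝ) : ℝ := fderiv ℝ F y (coordVec i, 0)

/-- The partial derivative `F_{,u}` of a function `F(x, u)`. -/
def du (F : Coord n × ℝ → ℝ) (y : Coord n × ℝ) : ℝ := fderiv ℝ F y (0, 1)

theorem fderiv_coordVec_add (F : Coord n × ℝ → ℝ) (y : Coord n × ℝ) (i : Fin n) (c : ℝ) :
    fderiv ℝ F y (coordVec i, c) = dx i F y + c * du F y := by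
  have : ((coordVec i, c) : Coord n × ℝ) = (coordVec i, 0) + c • ((0 : Coord n), (1 : ℝ)) := by
    simp
  rw [this, map_add, map_smul]; rfl

theorem sum_smul_coordVec (v : Coord n) : v = ∑ m, v m • coordVec m := by
  ext i
  simp [Finset.sum_apply, Pi.single_apply]

theorem fderiv_eq_sum_pderiv (f : Coord n → ℝ) (x v : Coord n) :
    fderiv ℝ f x v = ∑ m, v m * pderiv m f x := by
  conv_lhs => rw [sum_smul_coordVec v]
  simp [pderiv]

/-! ### Smoothness and symmetry of derivatives on open sets. -/

section smooth
variable {E : Type*} [NormedAddCommGroup E] [NormedSpace ℝ E] {U : Set E}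

theorem contDiffOn_fderiv_apply {f : E → ℝ} (hU : IsOpen U)
    (hf : ContDiffOn ℝ ∞ f U) (v : E) : ContDiffOn ℝ ∞ (fun y => fderiv ℝ f y v) U :=
  (hf.fderiv_of_isOpen hU (m := ∞) (by simp)).clm_apply contDiffOn_const

theorem _root_.ContDiffOn.diffAt {f : E → ℝ} {x : E} (hf : ContDiffOn ℝ ∞ f U) (hU : IsOpen U)
    (hx : x ∈ U) : DifferentiableAt ℝ f x :=
  (hf.differentiableOn (by simp)).differentiableAt (hU.mem_nhds hx)

theorem fderiv_fderiv_comm {f : E → ℝ} {x : E} (hf : ContDiffOn ℝ ∞ f U) (hU : IsOpen U)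
    (hx : x ∈ U) (v w : E) :
    fderiv ℝ (fun y => fderiv ℝ f y v) x w = fderiv ℝ (fun y => fderiv ℝ f y w) x v := by
  have hc : ContDiffAt ℝ ∞ f x := hf.contDiffAt (hU.mem_nhds hx)
  have hs : IsSymmSndFDerivAt ℝ f x := hc.isSymmSndFDerivAt
    (by simpa using WithTop.coe_le_coe.2 (le_top : (2 : ℕ∞) ≤ ⊤))
  have hd : DifferentiableAt ℝ (fderiv ℝ f) x :=
    (hc.fderiv_right (m := 1) (by norm_cast)).differentiableAt (by simp)
  rw [fderiv_clm_apply hd (differentiableAt_const v), fderiv_clm_apply hd (differentiableAt_const w)]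
  simpa using hs.eq w v

end smooth

theorem contDiffOn_pderiv {U : Set (Coord n)} {f : Coord n → ℝ} (hU : IsOpen U)
    (hf : ContDiffOn ℝ ∞ f U) (i : Fin n) : ContDiffOn ℝ ∞ (pderiv i f) U :=
  contDiffOn_fderiv_apply hU hf _

theorem pderiv_comm {U : Set (Coord n)} {f : Coord n → ℝ} {x : Coord n} (hU : IsOpen U)
    (hf : ContDiffOn ℝ ∞ f U) (hx : x ∈ U) (i j : Fin n) :
    pderiv i (pderiv j f) x = pderiv j (pderiv i f) x :=
  fderiv_fderiv_comm hf hU hx _ _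

end

section

variable {n : ℕ}

/-! ### Metrics on open subsets of coordinate space -/

/-- `G` is a smooth pseudo-Riemannian metric on the open set `U`. -/
structure IsLocalMetric (U : Set (Coord n)) (G : Coord n → Matrix (Fin n) (Fin n) ℝ) : Prop where
  isOpen : IsOpen U
  smooth : ∀ i j, ContDiffOn ℝ ∞ (fun x => G x i j) U
  symm : ∀ x ∈ U, ∀ i j, G x i j = G x j i
  isUnit : ∀ x ∈ U, IsUnit (G x).det

/-- The contracted Christoffel symbols `Γ^i = g^jk Γ^i_jk`. -/
def gam (G : Coord n → Matrix (Fin n) (Fin n) ℝ) (i : Fin n) (x : Coord n) : ℝ :=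
  ∑ j, ∑ k, (G x)⁻¹ j k * christoffel G x i j k

theorem contDiffOn_det {m : ℕ} {U : Set (Coord n)} {A : Coord n → Matrix (Fin m) (Fin m) ℝ}
    (hA : ∀ i j, ContDiffOn ℝ ∞ (fun x => A x i j) U) :
    ContDiffOn ℝ ∞ (fun x => (A x).det) U := by
  simp only [Matrix.det_apply]
  refine ContDiffOn.sum fun σ _ => ContDiffOn.const_smul _ ?_
  exact contDiffOn_prod fun i _ => hA _ _

namespace IsLocalMetric
variable {U : Set (Coord n)} {G : Coord n → Matrix (Fin n) (Fin n) ℝ} (h : IsLocalMetric U G)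
include h

/-- Cramer's rule: the entries are cofactors, polynomial in the entries of `G`, divided by a
nonvanishing determinant. -/
theorem smooth_inv (i j : Fin n) : ContDiffOn ℝ ∞ (fun x => (G x)⁻¹ i j) U := by
  have h1 : ContDiffOn ℝ ∞ (fun x => ((G x).det)⁻¹ * (G x).adjugate i j) U := by
    refine ContDiffOn.mul ((contDiffOn_det h.smooth).inv fun x hx => (h.isUnit x hx).ne_zero) ?_
    simp only [Matrix.adjugate_apply]
    refine contDiffOn_det fun k l => ?_
    by_cases hk : k = j
    · subst hk; simpa using contDiffOn_const
    · simpa [Matrix.updateRow_ne hk] using h.smooth k l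
  refine h1.congr fun x _ => ?_
  simp [Matrix.inv_def, Ring.inverse_eq_inv']

theorem smooth_gam (i : Fin n) : ContDiffOn ℝ ∞ (gam G i) U := by
  unfold gam christoffel
  refine ContDiffOn.sum fun j _ => ContDiffOn.sum fun k _ => (h.smooth_inv _ _).mul
    (contDiffOn_const.mul (ContDiffOn.sum fun l _ => (h.smooth_inv _ _).mul ?_))
  exact ((contDiffOn_pderiv h.isOpen (h.smooth _ _) _).add
    (contDiffOn_pderiv h.isOpen (h.smooth _ _) _)).sub
    (contDiffOn_pderiv h.isOpen (h.smooth _ _) _)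

theorem symm_inv {x : Coord n} (hx : x ∈ U) (i j : Fin n) : (G x)⁻¹ i j = (G x)⁻¹ j i := by
  have : (G x).transpose = G x := by ext i j; exact h.symm x hx j i
  conv_lhs => rw [← this, ← Matrix.transpose_nonsing_inv]
  rfl

theorem smooth_entry (i j : Fin n) {x : Coord n} (hx : x ∈ U) :
    DifferentiableAt ℝ (fun x => (G x)⁻¹ i j) x := (h.smooth_inv i j).diffAt h.isOpen hx

end IsLocalMetric

/-! ### The prolongation in terms of partial derivatives -/

theorem contDiffOn_dx {U : Set (Coord n)} (hU : IsOpen U) {F : Coord n × ℝ → ℝ}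
    (hF : ContDiffOn ℝ ∞ F (U ×ˢ Set.univ)) (i : Fin n) :
    ContDiffOn ℝ ∞ (dx i F) (U ×ˢ Set.univ) :=
  contDiffOn_fderiv_apply (hU.prod isOpen_univ) hF _

theorem contDiffOn_du {U : Set (Coord n)} (hU : IsOpen U) {F : Coord n × ℝ → ℝ}
    (hF : ContDiffOn ℝ ∞ F (U ×ˢ Set.univ)) : ContDiffOn ℝ ∞ (du F) (U ×ˢ Set.univ) :=
  contDiffOn_fderiv_apply (hU.prod isOpen_univ) hF _

theorem du_dx_comm {U : Set (Coord n)} (hU : IsOpen U) {F : Coord n × ℝ → ℝ}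
    (hF : ContDiffOn ℝ ∞ F (U ×ˢ Set.univ)) (i : Fin n) {x : Coord n} (hx : x ∈ U) (u : ℝ) :
    du (dx i F) (x, u) = dx i (du F) (x, u) :=
  fderiv_fderiv_comm hF (hU.prod isOpen_univ) (by simpa using hx) _ _

theorem prolong1_eq (ξ : Coord n × ℝ → Coord n) (η : Coord n × ℝ → ℝ) (i : Fin n) (z : Jet1 n) :
    prolong1 ξ η i z = dx i η (z.1, z.2.1) + z.2.2 i * du η (z.1, z.2.1)
      - ∑ k, z.2.2 k * (dx i (fun y => ξ y k) (z.1, z.2.1)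
        + z.2.2 i * du (fun y => ξ y k) (z.1, z.2.1)) := by
  simp only [prolong1, totalDeriv0, fderiv_coordVec_add]

/-- The projection of a first order jet to `(x, u)`. -/
def jetBase (n : ℕ) : Jet1 n →L[ℝ] Coord n × ℝ :=
  (ContinuousLinearMap.fst ℝ _ _).prod
    ((ContinuousLinearMap.fst ℝ _ _).comp (ContinuousLinearMap.snd ℝ _ _))

theorem HasDirDeriv.jetBase {F : Coord n × ℝ → ℝ} {x : Coord n} {u : ℝ} {p : Fin n → ℝ}
    (hF : DifferentiableAt ℝ F (x, u)) (j : Fin n) (c : ℝ) (r : Fin n → ℝ) :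
    HasDirDeriv (fun z : Jet1 n => F (z.1, z.2.1)) (x, u, p) (coordVec j, c, r)
      (dx j F (x, u) + c * du F (x, u)) := by
  have := (hF.hasDirDeriv (coordVec j, c)).congr_eq (fderiv_coordVec_add F (x, u) j c)
  exact HasDirDeriv.comp_clm (KleinGordon.jetBase n) this

theorem hasDirDeriv_jetSlope (x v : Coord n) (u c : ℝ) (p r : Fin n → ℝ) (k : Fin n) :
    HasDirDeriv (fun z : Jet1 n => z.2.2 k) (x, u, p) (v, c, r) (r k) :=
  HasDirDeriv.clm ((ContinuousLinearMap.proj (φ := fun _ : Fin n => ℝ) k).comp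
    ((ContinuousLinearMap.snd ℝ ℝ (Fin n → ℝ)).comp
      (ContinuousLinearMap.snd ℝ (Coord n) (ℝ × (Fin n → ℝ)))))

section
variable {U : Set (Coord n)} (hU : IsOpen U) {ξ : Coord n × ℝ → Coord n} {η : Coord n × ℝ → ℝ}
  (hξ : ∀ k, ContDiffOn ℝ ∞ (fun y => ξ y k) (U ×ˢ Set.univ))
  (hη : ContDiffOn ℝ ∞ η (U ×ˢ Set.univ))
include hU hξ hη

/-- Mixed derivatives are normalised to the order `dx (du _)`, and `q` is not yet assumed symmetric,
so `q j i` and `q i j` both occur. -/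
theorem prolong2_eq (i j : Fin n) {x : Coord n} (hx : x ∈ U) (u : ℝ) (p : Fin n → ℝ)
    (q : Fin n → Fin n → ℝ) :
    prolong2 ξ η i j (x, u, p, q) =
      dx j (dx i η) (x, u) + p j * dx i (du η) (x, u) + q j i * du η (x, u)
      + p i * (dx j (du η) (x, u) + p j * du (du η) (x, u))
      - ∑ k, (q j k * (dx i (fun y => ξ y k) (x, u) + p i * du (fun y => ξ y k) (x, u))
        + p k * (dx j (dx i (fun y => ξ y k)) (x, u) + p j * dx i (du (fun y => ξ y k)) (x, u)
          + q j i * du (fun y => ξ y k) (x, u)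
          + p i * (dx j (du (fun y => ξ y k)) (x, u) + p j * du (du (fun y => ξ y k)) (x, u))))
      - ∑ k, q i k * (dx j (fun y => ξ y k) (x, u) + p j * du (fun y => ξ y k) (x, u)) := by
  have hO : IsOpen (U ×ˢ (Set.univ : Set ℝ)) := hU.prod isOpen_univ
  have hm : (x, u) ∈ U ×ˢ (Set.univ : Set ℝ) := by simpa using hx
  have key : fderiv ℝ (prolong1 ξ η i) (x, u, p) (coordVec j, p j, q j) =
      (dx j (dx i η) (x, u) + p j * du (dx i η) (x, u)) + (q j i * du η (x, u)
        + p i * (dx j (du η) (x, u) + p j * du (du η) (x, u)))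
      - ∑ k, (q j k * (dx i (fun y => ξ y k) (x, u) + p i * du (fun y => ξ y k) (x, u))
        + p k * ((dx j (dx i (fun y => ξ y k)) (x, u) + p j * du (dx i (fun y => ξ y k)) (x, u))
          + (q j i * du (fun y => ξ y k) (x, u)
          + p i * (dx j (du (fun y => ξ y k)) (x, u)
            + p j * du (du (fun y => ξ y k)) (x, u))))) := by
    rw [funext (prolong1_eq ξ η i)]
    refine HasDirDeriv.eq (HasDirDeriv.sub (HasDirDeriv.add (.jetBase ?_ _ _ _)
      (.mul (hasDirDeriv_jetSlope _ _ _ _ _ _ _) (.jetBase ?_ _ _ _)))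
      (.sum fun k _ => .mul (hasDirDeriv_jetSlope _ _ _ _ _ _ _) (.add (.jetBase ?_ _ _ _)
        (.mul (hasDirDeriv_jetSlope _ _ _ _ _ _ _) (.jetBase ?_ _ _ _)))))
    · exact (contDiffOn_dx hU hη i).diffAt hO hm
    · exact (contDiffOn_du hU hη).diffAt hO hm
    · exact (contDiffOn_dx hU (hξ k) i).diffAt hO hm
    · exact (contDiffOn_du hU (hξ k)).diffAt hO hm
  simp only [prolong2, totalDeriv1, totalDeriv0, fderiv_coordVec_add]
  rw [key, du_dx_comm hU hη i hx u]
  simp only [fun k => du_dx_comm hU (hξ k) i hx u]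
  congr 1
  congr 1
  · ring
  · exact Finset.sum_congr rfl fun k _ => by ring

end

/-! ### The prolonged derivative of the Klein-Gordon equation -/

theorem kleinGordonJet_eq (G : Coord n → Matrix (Fin n) (Fin n) ℝ) (V : Coord n → ℝ) (z : Jet2 n) :
    kleinGordonJet G V z = ∑ i, ∑ j, (G z.1)⁻¹ i j * z.2.2.2 i j
      - ∑ i, gam G i z.1 * z.2.2.1 i - V z.1 * z.2.1 := rfl

/-- Each term of H is a function of x times a jet coordinate, so the product rule suffices. -/
theorem prolongedDeriv_kleinGordonJet {U : Set (Coord n)} {G : Coord n → Matrix (Fin n) (Fin n) ℝ}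
    (h : IsLocalMetric U G) {V : Coord n → ℝ} (hV : ContDiffOn ℝ ∞ V U)
    (ξ : Coord n × ℝ → Coord n) (η : Coord n × ℝ → ℝ) {x : Coord n} (hx : x ∈ U) (u : ℝ)
    (p : Fin n → ℝ) (q : Fin n → Fin n → ℝ) :
    prolongedDeriv ξ η (kleinGordonJet G V) (x, u, p, q) =
      ∑ i, ∑ j, (fderiv ℝ (fun y => (G y)⁻¹ i j) x (ξ (x, u)) * q i j
        + (G x)⁻¹ i j * prolong2 ξ η i j (x, u, p, q))
      - ∑ i, (fderiv ℝ (gam G i) x (ξ (x, u)) * p i + gam G i x * prolong1 ξ η i (x, u, p))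
      - (fderiv ℝ V x (ξ (x, u)) * u + V x * η (x, u)) := by
  refine HasDirDeriv.eq (?_ : HasDirDeriv (kleinGordonJet G V) (x, u, p, q) _ _)
  rw [funext (kleinGordonJet_eq G V)]
  have base : ∀ {F : Coord n → ℝ}, DifferentiableAt ℝ F x → ∀ w : Jet2 n,
      HasDirDeriv (fun z : Jet2 n => F z.1) (x, u, p, q) w (fderiv ℝ F x w.1) := fun hF w =>
    HasDirDeriv.comp_clm (ContinuousLinearMap.fst ℝ (Coord n)
      (ℝ × (Fin n → ℝ) × (Fin n → Fin n → ℝ))) (hF.hasDirDeriv _)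
  refine ((HasDirDeriv.sum fun i _ => .sum fun j _ => .mul (base (h.smooth_entry i j hx) _) ?_).sub
    (.sum fun i _ => .mul (base ((h.smooth_gam i).diffAt h.isOpen hx) _) ?_)).sub
    (.mul (base (hV.diffAt h.isOpen hx) _) ?_)
  · exact HasDirDeriv.clm (((ContinuousLinearMap.proj (φ := fun _ : Fin n => ℝ) j).comp
      (ContinuousLinearMap.proj (φ := fun _ : Fin n => Fin n → ℝ) i)).comp
      ((ContinuousLinearMap.snd ℝ (Fin n → ℝ) (Fin n → Fin n → ℝ)).comp
      ((ContinuousLinearMap.snd ℝ ℝ _).comp (ContinuousLinearMap.snd ℝ (Coord n) _))))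
  · exact HasDirDeriv.clm ((ContinuousLinearMap.proj (φ := fun _ : Fin n => ℝ) i).comp
      ((ContinuousLinearMap.fst ℝ (Fin n → ℝ) (Fin n → Fin n → ℝ)).comp
      ((ContinuousLinearMap.snd ℝ ℝ _).comp (ContinuousLinearMap.snd ℝ (Coord n) _))))
  · exact HasDirDeriv.clm ((ContinuousLinearMap.fst ℝ ℝ _).comp
      (ContinuousLinearMap.snd ℝ (Coord n) ((ℝ × (Fin n → ℝ) × (Fin n → Fin n → ℝ)))))

end

section

variable {n : ℕ}

/-! ### Linear algebra -/

/-- For a metric of any signature, the Euclidean square sum of the entries is a denominator that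
cannot vanish. -/
theorem sum_mul_self_pos {W : Fin n → Fin n → ℝ} (hW : ∃ i j, W i j ≠ 0) :
    0 < ∑ i, ∑ j, W i j * W i j := by
  obtain ⟨i, j, h⟩ := hW
  refine Finset.sum_pos' (fun a _ => Finset.sum_nonneg fun b _ => mul_self_nonneg _)
    ⟨i, Finset.mem_univ _, Finset.sum_pos' (fun b _ => mul_self_nonneg _)
    ⟨j, Finset.mem_univ _, mul_self_pos.2 h⟩⟩

theorem sum_sum_mul_linear (A P Q : Fin n → Fin n → ℝ) (s t : ℝ) :
    ∑ i, ∑ j, A i j * (s * P i j + t * Q i j)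
      = s * (∑ i, ∑ j, A i j * P i j) + t * ∑ i, ∑ j, A i j * Q i j := by
  simp only [Finset.mul_sum, ← Finset.sum_add_distrib]
  exact Finset.sum_congr rfl fun i _ => Finset.sum_congr rfl fun j _ => by ring

/-- An affine function of a symmetric matrix that vanishes on an affine hyperplane is a multiple of
the equation of the hyperplane. -/
theorem exists_multiplier {W A : Fin n → Fin n → ℝ} (hW : ∃ i j, W i j ≠ 0)
    (hWs : ∀ i j, W i j = W j i) (hAs : ∀ i j, A i j = A j i) {c B : ℝ}
    (h : ∀ q : Fin n → Fin n → ℝ, (∀ i j, q i j = q j i) → ∑ i, ∑ j, W i j * q i j = c →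
      ∑ i, ∑ j, A i j * q i j + B = 0) :
    ∃ μ : ℝ, (∀ i j, A i j = μ * W i j) ∧ B = - μ * c := by
  have hs := sum_mul_self_pos hW
  set s := ∑ i, ∑ j, W i j * W i j with hsd
  -- `μ W` is the orthogonal projection of `A` onto `W` in the entrywise Euclidean product, and `N`
  -- below is the orthogonal remainder.
  set μ := (∑ i, ∑ j, A i j * W i j) / s with hμ
  have hμs : ∑ i, ∑ j, A i j * W i j = μ * s := by rw [hμ]; field_simp
  set N : Fin n → Fin n → ℝ := fun i j => 1 * A i j + (-μ) * W i j with hN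
  have hWA : ∑ i, ∑ j, W i j * A i j = μ * s := by
    rw [← hμs]; simp only [mul_comm]
  have hWN : ∑ i, ∑ j, W i j * N i j = 0 := by
    rw [hN, sum_sum_mul_linear, hWA]; ring
  -- The matrices `(c / s) W + t N` lie on the hyperplane for every `t`. Comparing `t = 0` with `t =
  -- 1` gives both `B` and the orthogonality of `A` and `N`.
  have hq : ∀ t : ℝ, c / s * (μ * s) + t * (∑ i, ∑ j, A i j * N i j) + B = 0 := fun t => by
    rw [← hμs, ← sum_sum_mul_linear]
    refine h _ (fun i j => ?_) ?_
    · simp only [hN, hWs i j, hAs i j]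
    · rw [sum_sum_mul_linear, hWN, ← hsd]; field_simp; simp
  have h0 := hq 0
  have h1 := hq 1
  have hB : B = -μ * c := by
    have : c / s * (μ * s) = μ * c := by field_simp
    linarith
  refine ⟨μ, ?_, hB⟩
  have hNN : ∑ i, ∑ j, N i j * N i j = 0 := by
    have : ∑ i, ∑ j, N i j * N i j = ∑ i, ∑ j, N i j * (1 * A i j + (-μ) * W i j) := rfl
    rw [this, sum_sum_mul_linear]
    have e1 : ∑ i, ∑ j, N i j * A i j = ∑ i, ∑ j, A i j * N i j := by simp only [mul_comm]
    have e2 : ∑ i, ∑ j, N i j * W i j = ∑ i, ∑ j, W i j * N i j := by simp only [mul_comm]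
    rw [e1, e2, hWN]; linarith
  by_contra hne
  push Not at hne
  obtain ⟨i, j, hij⟩ := hne
  refine (sum_mul_self_pos (W := N) ⟨i, j, fun h0 => hij ?_⟩).ne' hNN
  simp only [hN] at h0; linarith

/-- A nondegenerate matrix of size at least two has no multiple of rank one. -/
theorem eq_zero_of_mul_eq {W : Matrix (Fin n) (Fin n) ℝ} (hW : IsUnit W.det) (hn : 2 ≤ n)
    {w : Fin n → ℝ} {ν : ℝ} (h : ∀ a b, w a * w b = ν * W a b) : w = 0 := by
  -- A nonzero `ν` would make `W` an outer product, of rank at most one, whereas its rank is `n ≥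
  -- 2`. With `ν = 0` the diagonal gives `w a * w a = 0`.
  have hν : ν = 0 := by
    by_contra hν
    have e : W = Matrix.vecMulVec (fun i => ν⁻¹ * w i) w := by
      ext a b
      simp only [Matrix.vecMulVec_apply, mul_assoc, h a b]
      field_simp
    have h1 := Matrix.rank_vecMulVec_le (fun i => ν⁻¹ * w i) w
    rw [← e, Matrix.rank_of_isUnit W ((Matrix.isUnit_iff_isUnit_det W).2 hW)] at h1
    simp at h1; omega
  ext a
  simpa [hν] using h a a

/-- A symmetric matrix with vanishing quadratic form vanishes. -/
theorem eq_zero_of_quadratic {W : Fin n → Fin n → ℝ} (hWs : ∀ i j, W i j = W j i)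
    (h : ∀ p : Fin n → ℝ, ∑ i, ∑ j, W i j * (p i * p j) = 0) (a b : Fin n) : W a b = 0 := by
  -- Polarisation.
  have e : ∀ p r : Fin n → ℝ, ∑ i, ∑ j, W i j * (p i * r j) = 0 := fun p r => by
    have h1 := h (p + r)
    have h2 : ∑ i, ∑ j, W i j * (r i * p j) = ∑ i, ∑ j, W i j * (p i * r j) := by
      rw [Finset.sum_comm]
      exact Finset.sum_congr rfl fun i _ => Finset.sum_congr rfl fun j _ => by
        rw [hWs j i]; ring
    have h3 : ∑ i, ∑ j, W i j * ((p + r) i * (p + r) j) = ∑ i, ∑ j, W i j * (p i * p j)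
        + ∑ i, ∑ j, W i j * (r i * r j) + ∑ i, ∑ j, W i j * (r i * p j)
        + ∑ i, ∑ j, W i j * (p i * r j) := by
      simp only [← Finset.sum_add_distrib, Pi.add_apply]
      exact Finset.sum_congr rfl fun i _ => Finset.sum_congr rfl fun j _ => by ring
    rw [h3, h p, h r, h2] at h1; linarith
  simpa [Pi.single_apply] using e (Pi.single a 1) (Pi.single b 1)

/-- The positive size matters: the empty zero matrix is invertible. -/
theorem IsLocalMetric.inv_ne_zero {U : Set (Coord n)} {G : Coord n → Matrix (Fin n) (Fin n) ℝ}
    (h : IsLocalMetric U G) (hn : 0 < n) {x : Coord n} (hx : x ∈ U) : ∃ i j, (G x)⁻¹ i j ≠ 0 := by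
  by_contra! hc
  have h0 : (G x)⁻¹ = 0 := by ext i j; exact hc i j
  have h1 := Matrix.isUnit_nonsing_inv_det (G x) (h.isUnit x hx)
  have : Nonempty (Fin n) := ⟨⟨0, hn⟩⟩
  rw [h0, Matrix.det_zero] at h1
  exact not_isUnit_zero h1

/-! ### The prolonged derivative as a polynomial in the jet variables -/

theorem sum_rotate (f : Fin n → Fin n → Fin n → ℝ) :
    ∑ i, ∑ j, ∑ k, f i j k = ∑ k, ∑ i, ∑ j, f i j k := by
  rw [Finset.sum_comm (f := fun k i => ∑ j, f i j k)]
  exact Finset.sum_congr rfl fun i _ => Finset.sum_comm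

theorem sum_mul_symm_swap {W q : Fin n → Fin n → ℝ} (hW : ∀ i j, W i j = W j i)
    (Y : Fin n → Fin n → ℝ) :
    ∑ i, ∑ j, W i j * ∑ k, q j k * Y k i = ∑ i, ∑ j, W i j * ∑ k, q i k * Y k j := by
  rw [Finset.sum_comm]
  exact Finset.sum_congr rfl fun i _ => Finset.sum_congr rfl fun j _ => by rw [hW]

/-- A symmetric `q` only sees the symmetric part of its coefficient. The symmetrised form is the one
to which `exists_multiplier` applies. -/
theorem two_mul_sum_contract {W q : Fin n → Fin n → ℝ} (hq : ∀ i j, q i j = q j i)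
    (Y : Fin n → Fin n → ℝ) :
    2 * ∑ i, ∑ j, W i j * ∑ k, q i k * Y k j
      = ∑ a, ∑ b, (∑ j, (W a j * Y b j + W b j * Y a j)) * q a b := by
  have h1 : ∑ i, ∑ j, W i j * ∑ k, q i k * Y k j = ∑ a, ∑ b, (∑ j, W a j * Y b j) * q a b := by
    refine Finset.sum_congr rfl fun i _ => ?_
    simp only [Finset.mul_sum, Finset.sum_mul]
    rw [Finset.sum_comm]
    exact Finset.sum_congr rfl fun j _ => Finset.sum_congr rfl fun k _ => by ring
  have h2 : ∑ a, ∑ b, (∑ j, W a j * Y b j) * q a b = ∑ a, ∑ b, (∑ j, W b j * Y a j) * q a b := by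
    rw [Finset.sum_comm]
    exact Finset.sum_congr rfl fun i _ => Finset.sum_congr rfl fun j _ => by rw [hq]
  rw [two_mul, h1]
  nth_rw 2 [h2]
  simp only [← Finset.sum_add_distrib, ← add_mul]

section
variable {U : Set (Coord n)} {G : Coord n → Matrix (Fin n) (Fin n) ℝ} (h : IsLocalMetric U G)
  {V : Coord n → ℝ} (hV : ContDiffOn ℝ ∞ V U) {ξ : Coord n × ℝ → Coord n} {η : Coord n × ℝ → ℝ}
  (hξ : ∀ k, ContDiffOn ℝ ∞ (fun y => ξ y k) (U ×ˢ Set.univ))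
  (hη : ContDiffOn ℝ ∞ η (U ×ˢ Set.univ))
include h hV hξ hη

/-- The prolonged derivative is affine in the second order jet variables. -/
theorem prolongedDeriv_affine {x : Coord n} (hx : x ∈ U) (u : ℝ)
    (p : Fin n → ℝ) {q : Fin n → Fin n → ℝ} (hq : ∀ i j, q i j = q j i) :
    prolongedDeriv ξ η (kleinGordonJet G V) (x, u, p, q) =
      ∑ a, ∑ b, (fderiv ℝ (fun y => (G y)⁻¹ a b) x (ξ (x, u))
        + (du η (x, u) - ∑ k, p k * du (fun y => ξ y k) (x, u)) * (G x)⁻¹ a b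
        - ∑ j, ((G x)⁻¹ a j * (dx j (fun y => ξ y b) (x, u) + p j * du (fun y => ξ y b) (x, u))
          + (G x)⁻¹ b j * (dx j (fun y => ξ y a) (x, u) + p j * du (fun y => ξ y a) (x, u))))
          * q a b
      + prolongedDeriv ξ η (kleinGordonJet G V) (x, u, p, 0) := by
  set W := (G x)⁻¹ with hW
  have hWs : ∀ i j, W i j = W j i := h.symm_inv hx
  -- `Y k i` is the total derivative D_i ξ^k. The second order jet enters `prolong2` through η_,u -
  -- u_k ξ^k_,u and through two contractions with `Y`.
  set Y : Fin n → Fin n → ℝ := fun k i =>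
    dx i (fun y => ξ y k) (x, u) + p i * du (fun y => ξ y k) (x, u) with hY
  have hp2 : ∀ i j, prolong2 ξ η i j (x, u, p, q) = prolong2 ξ η i j (x, u, p, 0)
      + (du η (x, u) - ∑ k, p k * du (fun y => ξ y k) (x, u)) * q i j
      - ∑ k, q j k * Y k i - ∑ k, q i k * Y k j := fun i j => by
    rw [prolong2_eq h.isOpen hξ hη i j hx, prolong2_eq h.isOpen hξ hη i j hx, sub_mul,
      Finset.sum_mul]
    simp only [hY, Pi.zero_apply, zero_mul, Finset.sum_const_zero, zero_add, add_zero, sub_zero,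
      mul_add, Finset.sum_add_distrib, hq j i]
    have : ∑ k, p k * (q i j * du (fun y => ξ y k) (x, u))
      = ∑ k, p k * du (fun y => ξ y k) (x, u) * q i j :=
      Finset.sum_congr rfl fun k _ => by ring
    rw [this]; ring
  rw [prolongedDeriv_kleinGordonJet h hV ξ η hx, prolongedDeriv_kleinGordonJet h hV ξ η hx]
  have e := two_mul_sum_contract (W := W) hq Y
  have e2 := sum_mul_symm_swap (q := q) hWs Y
  have e3 : ∑ i, ∑ j, (fderiv ℝ (fun y => (G y)⁻¹ i j) x (ξ (x, u)) * q i j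
      + W i j * prolong2 ξ η i j (x, u, p, q))
      = ∑ i, ∑ j, (fderiv ℝ (fun y => (G y)⁻¹ i j) x (ξ (x, u))
        + (du η (x, u) - ∑ k, p k * du (fun y => ξ y k) (x, u)) * W i j) * q i j
        - ∑ i, ∑ j, W i j * ∑ k, q j k * Y k i - ∑ i, ∑ j, W i j * ∑ k, q i k * Y k j
        + ∑ i, ∑ j, W i j * prolong2 ξ η i j (x, u, p, 0) := by
    simp only [← Finset.sum_add_distrib, ← Finset.sum_sub_distrib]
    exact Finset.sum_congr rfl fun i _ => Finset.sum_congr rfl fun j _ => by rw [hp2]; ring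
  have e4 : ∑ a, ∑ b, (fderiv ℝ (fun y => (G y)⁻¹ a b) x (ξ (x, u))
      + (du η (x, u) - ∑ k, p k * du (fun y => ξ y k) (x, u)) * W a b
      - ∑ j, (W a j * Y b j + W b j * Y a j)) * q a b
      = ∑ i, ∑ j, (fderiv ℝ (fun y => (G y)⁻¹ i j) x (ξ (x, u))
        + (du η (x, u) - ∑ k, p k * du (fun y => ξ y k) (x, u)) * W i j) * q i j
        - ∑ a, ∑ b, (∑ j, (W a j * Y b j + W b j * Y a j)) * q a b := by
    simp only [← Finset.sum_sub_distrib, ← sub_mul]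
  rw [e3, e4, ← e, e2]
  simp only [Pi.zero_apply, mul_zero, zero_add]
  ring

/-- Once ξ is independent of u, this value is a quadratic polynomial in `p`. Its three coefficients
carry η_,uu, the first order equation linking η_,u to ξ, and the Klein-Gordon operator applied to η.
-/
theorem prolongedDeriv_zero (hu : ∀ x ∈ U, ∀ u k, du (fun y => ξ y k) (x, u) = 0)
    {x : Coord n} (hx : x ∈ U) (u : ℝ) (p : Fin n → ℝ) :
    prolongedDeriv ξ η (kleinGordonJet G V) (x, u, p, 0) =
      du (du η) (x, u) * ∑ i, ∑ j, (G x)⁻¹ i j * (p i * p j)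
      + ∑ i, (2 * ∑ j, (G x)⁻¹ i j * dx j (du η) (x, u)
        - ∑ j, ∑ k, (G x)⁻¹ j k * dx k (dx j (fun y => ξ y i)) (x, u)
        - fderiv ℝ (gam G i) x (ξ (x, u)) - gam G i x * du η (x, u)
        + ∑ j, gam G j x * dx j (fun y => ξ y i) (x, u)) * p i
      + (∑ i, ∑ j, (G x)⁻¹ i j * dx j (dx i η) (x, u) - ∑ i, gam G i x * dx i η (x, u)
        - fderiv ℝ V x (ξ (x, u)) * u - V x * η (x, u)) := by
  have hWs : ∀ i j, (G x)⁻¹ i j = (G x)⁻¹ j i := h.symm_inv hx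
  -- Second derivatives of ξ involving u vanish because ξ_,u does so on a neighbourhood, not only at
  -- the point.
  have hev : ∀ k, du (fun y => ξ y k) =ᶠ[nhds (x, u)] fun _ => 0 := fun k => by
    filter_upwards [(h.isOpen.prod isOpen_univ).mem_nhds (show (x, u) ∈ U ×ˢ Set.univ by simpa)]
      with y hy
    exact hu y.1 hy.1 y.2 k
  have hdx : ∀ j k, dx j (du (fun y => ξ y k)) (x, u) = 0 := fun j k => by
    simp [dx, (hev k).fderiv_eq]
  have hdu : ∀ k, du (du (fun y => ξ y k)) (x, u) = 0 := fun k => by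
    unfold du; erw [(hev k).fderiv_eq]; simp
  rw [prolongedDeriv_kleinGordonJet h hV ξ η hx]
  simp only [prolong2_eq h.isOpen hξ hη _ _ hx, prolong1_eq, hdx, hdu, hu x hx, Pi.zero_apply,
    zero_mul, mul_zero, add_zero, zero_add, Finset.sum_const_zero, sub_zero]
  have e1 : ∑ i, ∑ j, (G x)⁻¹ i j * (dx j (dx i η) (x, u) + p j * dx i (du η) (x, u)
      + p i * (dx j (du η) (x, u) + p j * du (du η) (x, u))
      - ∑ k, p k * dx j (dx i (fun y => ξ y k)) (x, u))
      = ∑ i, ∑ j, (G x)⁻¹ i j * dx j (dx i η) (x, u)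
        + ∑ i, ∑ j, (G x)⁻¹ i j * (p j * dx i (du η) (x, u))
        + ∑ i, ∑ j, (G x)⁻¹ i j * (p i * dx j (du η) (x, u))
        + du (du η) (x, u) * ∑ i, ∑ j, (G x)⁻¹ i j * (p i * p j)
        - ∑ i, ∑ j, ∑ k, (G x)⁻¹ i j * (p k * dx j (dx i (fun y => ξ y k)) (x, u)) := by
    simp only [Finset.mul_sum, ← Finset.sum_add_distrib, ← Finset.sum_sub_distrib]
    refine Finset.sum_congr rfl fun i _ => Finset.sum_congr rfl fun j _ => ?_
    rw [mul_sub, Finset.mul_sum]; ring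
  have e2 : ∑ i, ∑ j, (G x)⁻¹ i j * (p j * dx i (du η) (x, u))
      = ∑ i, ∑ j, (G x)⁻¹ i j * (p i * dx j (du η) (x, u)) := by
    rw [Finset.sum_comm]
    exact Finset.sum_congr rfl fun i _ => Finset.sum_congr rfl fun j _ => by rw [hWs]
  have e3 : ∑ i, ∑ j, ∑ k, (G x)⁻¹ i j * (p k * dx j (dx i (fun y => ξ y k)) (x, u))
      = ∑ i, (∑ j, ∑ k, (G x)⁻¹ j k * dx k (dx j (fun y => ξ y i)) (x, u)) * p i := by
    rw [sum_rotate]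
    simp only [Finset.sum_mul]
    exact Finset.sum_congr rfl fun k _ => Finset.sum_congr rfl fun i _ =>
      Finset.sum_congr rfl fun j _ => by ring
  have e4 : ∑ i, (fderiv ℝ (gam G i) x (ξ (x, u)) * p i + gam G i x * (dx i η (x, u)
      + p i * du η (x, u) - ∑ k, p k * dx i (fun y => ξ y k) (x, u)))
      = ∑ i, (fderiv ℝ (gam G i) x (ξ (x, u)) + gam G i x * du η (x, u)) * p i
        + ∑ i, gam G i x * dx i η (x, u)
        - ∑ i, (∑ j, gam G j x * dx j (fun y => ξ y i) (x, u)) * p i := by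
    have : ∑ i, (∑ j, gam G j x * dx j (fun y => ξ y i) (x, u)) * p i
        = ∑ i, gam G i x * ∑ k, p k * dx i (fun y => ξ y k) (x, u) := by
      simp only [Finset.sum_mul, Finset.mul_sum]
      rw [Finset.sum_comm]
      exact Finset.sum_congr rfl fun i _ => Finset.sum_congr rfl fun j _ => by ring
    rw [this, ← Finset.sum_add_distrib, ← Finset.sum_sub_distrib]
    exact Finset.sum_congr rfl fun i _ => by ring
  have e5 : ∑ i, ∑ j, (G x)⁻¹ i j * (p i * dx j (du η) (x, u))
      = ∑ i, (∑ j, (G x)⁻¹ i j * dx j (du η) (x, u)) * p i := by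
    simp only [Finset.sum_mul]
    exact Finset.sum_congr rfl fun i _ => Finset.sum_congr rfl fun j _ => by ring
  have e6 : ∑ i, (2 * ∑ j, (G x)⁻¹ i j * dx j (du η) (x, u)
        - ∑ j, ∑ k, (G x)⁻¹ j k * dx k (dx j (fun y => ξ y i)) (x, u)
        - fderiv ℝ (gam G i) x (ξ (x, u)) - gam G i x * du η (x, u)
        + ∑ j, gam G j x * dx j (fun y => ξ y i) (x, u)) * p i
      = 2 * ∑ i, (∑ j, (G x)⁻¹ i j * dx j (du η) (x, u)) * p i
        - ∑ i, (∑ j, ∑ k, (G x)⁻¹ j k * dx k (dx j (fun y => ξ y i)) (x, u)) * p i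
        - ∑ i, (fderiv ℝ (gam G i) x (ξ (x, u)) + gam G i x * du η (x, u)) * p i
        + ∑ i, (∑ j, gam G j x * dx j (fun y => ξ y i) (x, u)) * p i := by
    rw [Finset.mul_sum, ← Finset.sum_sub_distrib, ← Finset.sum_sub_distrib,
      ← Finset.sum_add_distrib]
    exact Finset.sum_congr rfl fun i _ => by ring
  rw [e1, e2, e3, e4, e5, e6]
  ring

end

end

section

variable {n : ℕ}

/-! ### Conformal Killing vectors of a metric on an open subset of coordinate space -/

/-- The entrywise derivative of a matrix valued function. -/
def matDeriv (A : Coord n → Matrix (Fin n) (Fin n) ℝ) (x v : Coord n) : Matrix (Fin n) (Fin n) ℝ :=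
  Matrix.of fun i j => fderiv ℝ (fun y => A y i j) x v

/-- The Jacobian matrix `ζ^k_{,i}` of a vector field. -/
def jacobian (ζ : Coord n → Coord n) (x : Coord n) : Matrix (Fin n) (Fin n) ℝ :=
  Matrix.of fun k i => pderiv i (fun y => ζ y k) x

theorem lieDerivMetric_eq (G : Coord n → Matrix (Fin n) (Fin n) ℝ) (ζ : Coord n → Coord n)
    (x : Coord n) (i j : Fin n) : lieDerivMetric G ζ x i j =
      (matDeriv G x (ζ x) + (jacobian ζ x).transpose * G x + G x * jacobian ζ x) i j := by
  simp only [lieDerivMetric, Finset.sum_add_distrib, Matrix.add_apply, Matrix.mul_apply, matDeriv,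
    Matrix.of_apply, fderiv_eq_sum_pderiv, jacobian, Matrix.transpose_apply, mul_comm]

/-- The functions `½ g^jk g_jk,l`, the logarithmic derivatives of the volume density. -/
def logVol (G : Coord n → Matrix (Fin n) (Fin n) ℝ) (l : Fin n) (x : Coord n) : ℝ :=
  (1 / 2) * ∑ j, ∑ k, (G x)⁻¹ j k * pderiv l (fun y => G y j k) x

namespace IsLocalMetric
variable {U : Set (Coord n)} {G : Coord n → Matrix (Fin n) (Fin n) ℝ} (h : IsLocalMetric U G)
include h

theorem mul_inv {x : Coord n} (hx : x ∈ U) : G x * (G x)⁻¹ = 1 :=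
  Matrix.mul_nonsing_inv _ (h.isUnit x hx)

theorem inv_mul {x : Coord n} (hx : x ∈ U) : (G x)⁻¹ * G x = 1 :=
  Matrix.nonsing_inv_mul _ (h.isUnit x hx)

/-- Differentiate `G * G⁻¹ = 1`. -/
theorem matDeriv_inv {x : Coord n} (hx : x ∈ U) (v : Coord n) :
    matDeriv (fun y => (G y)⁻¹) x v = - ((G x)⁻¹ * matDeriv G x v * (G x)⁻¹) := by
  have e : matDeriv G x v * (G x)⁻¹ + G x * matDeriv (fun y => (G y)⁻¹) x v = 0 := by
    ext a b
    have h1 : HasDirDeriv (fun y => ∑ c, G y a c * (G y)⁻¹ c b) x v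
        (∑ c, (fderiv ℝ (fun y => G y a c) x v * (G x)⁻¹ c b
          + G x a c * fderiv ℝ (fun y => (G y)⁻¹ c b) x v)) :=
      .sum fun c _ => .mul (((h.smooth a c).diffAt h.isOpen hx).hasDirDeriv v)
        ((h.smooth_entry c b hx).hasDirDeriv v)
    have h2 : (fun y => ∑ c, G y a c * (G y)⁻¹ c b) =ᶠ[nhds x]
        fun _ => (1 : Matrix (Fin n) (Fin n) ℝ) a b := by
      filter_upwards [h.isOpen.mem_nhds hx] with y hy
      rw [← h.mul_inv hy, Matrix.mul_apply]
    have h3 := h1.eq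
    rw [h2.fderiv_eq] at h3
    simp only [Finset.sum_add_distrib] at h3
    simpa [Matrix.mul_apply, matDeriv] using h3.symm
  have e2 := congrArg (fun A => (G x)⁻¹ * A) e
  simp only [mul_add, ← mul_assoc, h.inv_mul hx, one_mul, mul_zero] at e2
  exact eq_neg_of_add_eq_zero_right e2

/-- The Lie derivative of the metric in terms of that of the inverse metric. -/
theorem lieDeriv_inv_eq (ζ : Coord n → Coord n) {x : Coord n} (hx : x ∈ U) :
    matDeriv (fun y => (G y)⁻¹) x (ζ x) - (G x)⁻¹ * (jacobian ζ x).transpose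
      - jacobian ζ x * (G x)⁻¹
      = - ((G x)⁻¹ * Matrix.of (lieDerivMetric G ζ x) * (G x)⁻¹) := by
  have e : Matrix.of (lieDerivMetric G ζ x) =
      matDeriv G x (ζ x) + (jacobian ζ x).transpose * G x + G x * jacobian ζ x := by
    ext i j; exact lieDerivMetric_eq G ζ x i j
  rw [e, h.matDeriv_inv hx]
  simp only [mul_add, add_mul, mul_assoc, h.mul_inv hx, mul_one]
  simp only [← mul_assoc, h.inv_mul hx, one_mul]
  abel

/-- The leading coefficients of the Klein-Gordon operator are g^ij, so a symmetry speaks about L_ζ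
of the inverse metric. Conjugating by `G` turns L_ζ g into -L_ζ g⁻¹ and back. -/
theorem lieDerivMetric_iff (ζ : Coord n → Coord n) {x : Coord n} (hx : x ∈ U) (ψ : ℝ) :
    (∀ i j, lieDerivMetric G ζ x i j = 2 * ψ * G x i j) ↔
    ∀ a b, fderiv ℝ (fun y => (G y)⁻¹ a b) x (ζ x)
      - ∑ j, ((G x)⁻¹ a j * pderiv j (fun y => ζ y b) x
        + (G x)⁻¹ b j * pderiv j (fun y => ζ y a) x) = -2 * ψ * (G x)⁻¹ a b := by
  have e := h.lieDeriv_inv_eq ζ hx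
  have e1 : ∀ a b, fderiv ℝ (fun y => (G y)⁻¹ a b) x (ζ x)
      - ∑ j, ((G x)⁻¹ a j * pderiv j (fun y => ζ y b) x
        + (G x)⁻¹ b j * pderiv j (fun y => ζ y a) x) =
      (matDeriv (fun y => (G y)⁻¹) x (ζ x) - (G x)⁻¹ * (jacobian ζ x).transpose
      - jacobian ζ x * (G x)⁻¹) a b := fun a b => by
    simp only [Matrix.sub_apply, matDeriv, Matrix.of_apply, Matrix.mul_apply, jacobian,
      Matrix.transpose_apply, Finset.sum_add_distrib, sub_sub, h.symm_inv hx b, mul_comm]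
  simp only [e1, e]
  constructor
  · intro hL a b
    have : Matrix.of (lieDerivMetric G ζ x) = (2 * ψ) • G x := by ext i j; exact hL i j
    rw [this]
    simp [h.inv_mul hx]
  · intro hS
    have h1 : (G x)⁻¹ * Matrix.of (lieDerivMetric G ζ x) * (G x)⁻¹ = (2 * ψ) • (G x)⁻¹ := by
      ext a b
      have := hS a b
      simp only [Matrix.neg_apply, Matrix.smul_apply, smul_eq_mul] at this ⊢
      linarith
    have h2 : G x * ((G x)⁻¹ * Matrix.of (lieDerivMetric G ζ x) * (G x)⁻¹) * G x
        = (2 * ψ) • G x := by rw [h1]; simp [h.mul_inv hx]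
    simp only [mul_assoc, h.inv_mul hx, mul_one] at h2
    rw [← mul_assoc, h.mul_inv hx, one_mul] at h2
    intro i j
    exact congrFun (congrFun h2 i) j

/-- In this divergence form, differentiating Γ^i along a field needs only derivatives of g^ik and of
the logarithmic volume density, both of which the conformal Killing equation controls. -/
theorem gam_eq {x : Coord n} (hx : x ∈ U) (i : Fin n) :
    gam G i x = - ∑ k, pderiv k (fun y => (G y)⁻¹ i k) x - ∑ l, (G x)⁻¹ i l * logVol G l x := by
  have hd : ∀ k, pderiv k (fun y => (G y)⁻¹ i k) x
      = - ∑ j, (∑ l, (G x)⁻¹ i l * pderiv k (fun y => G y l j) x) * (G x)⁻¹ j k := fun k => by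
    have := congrFun (congrFun (h.matDeriv_inv hx (coordVec k)) i) k
    simpa [matDeriv, Matrix.mul_apply, pderiv] using this
  have e1 : gam G i x = 1 / 2 * ∑ j, ∑ k, ∑ l, (G x)⁻¹ j k * (G x)⁻¹ i l * pderiv j (fun y => G y l k) x
      + 1 / 2 * ∑ j, ∑ k, ∑ l, (G x)⁻¹ j k * (G x)⁻¹ i l * pderiv k (fun y => G y l j) x
      - 1 / 2 * ∑ j, ∑ k, ∑ l, (G x)⁻¹ j k * (G x)⁻¹ i l * pderiv l (fun y => G y j k) x := by
    simp only [gam, christoffel, Finset.mul_sum, ← Finset.sum_add_distrib,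
      ← Finset.sum_sub_distrib]
    refine Finset.sum_congr rfl fun j _ => Finset.sum_congr rfl fun k _ =>
      Finset.sum_congr rfl fun l _ => ?_
    ring
  have e2 : ∑ j, ∑ k, ∑ l, (G x)⁻¹ j k * (G x)⁻¹ i l * pderiv j (fun y => G y l k) x
      = ∑ j, ∑ k, ∑ l, (G x)⁻¹ j k * (G x)⁻¹ i l * pderiv k (fun y => G y l j) x := by
    rw [Finset.sum_comm]
    refine Finset.sum_congr rfl fun j _ => Finset.sum_congr rfl fun k _ =>
      Finset.sum_congr rfl fun l _ => ?_
    rw [h.symm_inv hx]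
  have e3 : ∑ j, ∑ k, ∑ l, (G x)⁻¹ j k * (G x)⁻¹ i l * pderiv l (fun y => G y j k) x
      = 2 * ∑ l, (G x)⁻¹ i l * logVol G l x := by
    rw [sum_rotate, Finset.mul_sum]
    refine Finset.sum_congr rfl fun l _ => ?_
    simp only [logVol, Finset.mul_sum]
    refine Finset.sum_congr rfl fun j _ => Finset.sum_congr rfl fun k _ => ?_
    ring
  have e4 : ∑ j, ∑ k, ∑ l, (G x)⁻¹ j k * (G x)⁻¹ i l * pderiv k (fun y => G y l j) x
      = - ∑ k, pderiv k (fun y => (G y)⁻¹ i k) x := by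
    simp only [hd, Finset.sum_neg_distrib, neg_neg]
    rw [Finset.sum_comm]
    refine Finset.sum_congr rfl fun k _ => Finset.sum_congr rfl fun j _ => ?_
    rw [Finset.sum_mul]
    exact Finset.sum_congr rfl fun l _ => by ring
  rw [e1, e2, e3, e4]; ring

theorem smooth_logVol (l : Fin n) : ContDiffOn ℝ ∞ (logVol G l) U := by
  unfold logVol
  exact contDiffOn_const.mul (ContDiffOn.sum fun j _ => ContDiffOn.sum fun k _ =>
    (h.smooth_inv _ _).mul (contDiffOn_pderiv h.isOpen (h.smooth _ _) _))

theorem pderiv_logVol {x : Coord n} (hx : x ∈ U) (m l : Fin n) :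
    pderiv m (logVol G l) x = (1 / 2) *
      (∑ j, ∑ k, (G x)⁻¹ j k * pderiv m (pderiv l (fun y => G y j k)) x
        - ((G x)⁻¹ * matDeriv G x (coordVec m) * (G x)⁻¹ * matDeriv G x (coordVec l)).trace) := by
  have h1 : HasDirDeriv (logVol G l) x (coordVec m) ((1 / 2) *
      ∑ j, ∑ k, (pderiv m (fun y => (G y)⁻¹ j k) x * pderiv l (fun y => G y j k) x
        + (G x)⁻¹ j k * pderiv m (pderiv l (fun y => G y j k)) x)) :=
    .const_mul _ (.sum fun j _ => .sum fun k _ => .mul ((h.smooth_entry j k hx).hasDirDeriv _)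
      (((contDiffOn_pderiv h.isOpen (h.smooth j k) l).diffAt h.isOpen hx).hasDirDeriv _))
  have h2 : ∑ j, ∑ k, pderiv m (fun y => (G y)⁻¹ j k) x * pderiv l (fun y => G y j k) x
      = (matDeriv (fun y => (G y)⁻¹) x (coordVec m) * matDeriv G x (coordVec l)).trace := by
    simp only [Matrix.trace, Matrix.diag, Matrix.mul_apply]
    refine Finset.sum_congr rfl fun j _ => Finset.sum_congr rfl fun k _ => ?_
    have : (fun y => G y j k) =ᶠ[nhds x] fun y => G y k j := by
      filter_upwards [h.isOpen.mem_nhds hx] with y hy using h.symm y hy j k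
    simp only [matDeriv, Matrix.of_apply, pderiv, this.fderiv_eq]
  rw [pderiv, h1.eq]
  simp only [Finset.sum_add_distrib]
  rw [h2, h.matDeriv_inv hx, Matrix.neg_mul, Matrix.trace_neg]
  ring

/-- The 1-form `logVol` is closed. Working from its formula avoids the logarithm of a determinant:
one term is symmetric as second partials commute, the other by cyclicity of the trace. -/
theorem pderiv_logVol_comm {x : Coord n} (hx : x ∈ U) (m l : Fin n) :
    pderiv m (logVol G l) x = pderiv l (logVol G m) x := by
  rw [h.pderiv_logVol hx, h.pderiv_logVol hx]
  congr 2
  · exact Finset.sum_congr rfl fun j _ => Finset.sum_congr rfl fun k _ => by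
      rw [pderiv_comm h.isOpen (h.smooth j k) hx]
  · rw [mul_assoc, Matrix.trace_mul_comm, ← mul_assoc]

end IsLocalMetric

end

/-! ### Trace and derivatives of the conformal Killing equation. -/

section

variable {n : ℕ}

namespace IsLocalMetric
variable {U : Set (Coord n)} {G : Coord n → Matrix (Fin n) (Fin n) ℝ} (h : IsLocalMetric U G)
  {ζ : Coord n → Coord n} {ψ : Coord n → ℝ}
include h

/-- The trace of the conformal Killing equation. -/
theorem divergence_eq {x : Coord n} (hx : x ∈ U) {c : ℝ}
    (hL : ∀ i j, lieDerivMetric G ζ x i j = 2 * c * G x i j) :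
    ∑ m, ζ x m * logVol G m x + ∑ a, pderiv a (fun y => ζ y a) x = n * c := by
  have e : matDeriv G x (ζ x) + (jacobian ζ x).transpose * G x + G x * jacobian ζ x
      = (2 * c) • G x := by
    ext i j; rw [← lieDerivMetric_eq, hL]; rfl
  have e1 := congrArg (fun A => ((G x)⁻¹ * A).trace) e
  simp only [mul_add, Matrix.trace_add, Matrix.mul_smul, Matrix.trace_smul, h.inv_mul hx,
    Matrix.trace_one, Fintype.card_fin, smul_eq_mul, ← mul_assoc (G x)⁻¹ (G x), one_mul] at e1
  rw [Matrix.trace_mul_comm (G x)⁻¹ ((jacobian ζ x).transpose * G x), mul_assoc, h.mul_inv hx,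
    mul_one, Matrix.trace_transpose] at e1
  have e2 : (matDeriv G x (ζ x) * (G x)⁻¹).trace = 2 * ∑ m, ζ x m * logVol G m x := by
    simp only [logVol, Finset.mul_sum, Matrix.trace, Matrix.diag, Matrix.mul_apply, matDeriv,
      Matrix.of_apply, fderiv_eq_sum_pderiv, Finset.sum_mul]
    rw [sum_rotate]
    refine Finset.sum_congr rfl fun m _ => Finset.sum_congr rfl fun j _ =>
      Finset.sum_congr rfl fun k _ => ?_
    rw [h.symm_inv hx k j]; ring
  have e3 : (jacobian ζ x).trace = ∑ a, pderiv a (fun y => ζ y a) x := rfl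
  rw [Matrix.trace_mul_comm, e2, e3] at e1
  linarith

theorem sum_mul_pderiv_inv (hL : ∀ x ∈ U, ∀ i j, lieDerivMetric G ζ x i j = 2 * ψ x * G x i j)
    {x : Coord n} (hx : x ∈ U) (a b : Fin n) :
    ∑ m, ζ x m * pderiv m (fun y => (G y)⁻¹ a b) x = -2 * ψ x * (G x)⁻¹ a b
      + ∑ j, ((G x)⁻¹ a j * pderiv j (fun y => ζ y b) x
        + (G x)⁻¹ j b * pderiv j (fun y => ζ y a) x) := by
  have e := (h.lieDerivMetric_iff ζ hx (ψ x)).1 (hL x hx) a b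
  rw [fderiv_eq_sum_pderiv] at e
  simp only [h.symm_inv hx b] at e
  linarith

variable (hζ : ∀ k, ContDiffOn ℝ ∞ (fun y => ζ y k) U) (hψ : ContDiffOn ℝ ∞ ψ U)
  (hL : ∀ x ∈ U, ∀ i j, lieDerivMetric G ζ x i j = 2 * ψ x * G x i j)
include hζ hψ hL

/-- Take ∂_k of L_ζ g^ik = -2ψ g^ik, sum over k, and commute ∂_k past the derivative along ζ. -/
theorem sum_fderiv_pderiv_inv {x : Coord n} (hx : x ∈ U) (i : Fin n) :
    ∑ k, fderiv ℝ (pderiv k (fun y => (G y)⁻¹ i k)) x (ζ x) =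
      -2 * ∑ k, (G x)⁻¹ i k * pderiv k ψ x
      - 2 * ψ x * ∑ k, pderiv k (fun y => (G y)⁻¹ i k) x
      + ∑ j, (G x)⁻¹ i j * ∑ k, pderiv j (pderiv k (fun y => ζ y k)) x
      + ∑ j, (∑ k, pderiv k (fun y => (G y)⁻¹ j k) x) * pderiv j (fun y => ζ y i) x
      + ∑ j, ∑ k, (G x)⁻¹ j k * pderiv k (pderiv j (fun y => ζ y i)) x := by
  have hpW : ∀ a b m, DifferentiableAt ℝ (pderiv m (fun y => (G y)⁻¹ a b)) x := fun a b m =>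
    (contDiffOn_pderiv h.isOpen (h.smooth_inv a b) m).diffAt h.isOpen hx
  have hpζ : ∀ k m, DifferentiableAt ℝ (pderiv m (fun y => ζ y k)) x := fun k m =>
    (contDiffOn_pderiv h.isOpen (hζ k) m).diffAt h.isOpen hx
  have hdζ : ∀ k, DifferentiableAt ℝ (fun y => ζ y k) x := fun k => (hζ k).diffAt h.isOpen hx
  have key : ∀ k, ∑ m, (pderiv k (fun y => ζ y m) x * pderiv m (fun y => (G y)⁻¹ i k) x
      + ζ x m * pderiv k (pderiv m (fun y => (G y)⁻¹ i k)) x)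
      = (-2 * pderiv k ψ x) * (G x)⁻¹ i k + (-2 * ψ x) * pderiv k (fun y => (G y)⁻¹ i k) x
      + ∑ j, ((pderiv k (fun y => (G y)⁻¹ i j) x * pderiv j (fun y => ζ y k) x
          + (G x)⁻¹ i j * pderiv k (pderiv j (fun y => ζ y k)) x)
        + (pderiv k (fun y => (G y)⁻¹ j k) x * pderiv j (fun y => ζ y i) x
          + (G x)⁻¹ j k * pderiv k (pderiv j (fun y => ζ y i)) x)) := fun k => by
    have l : HasDirDeriv (fun y => ∑ m, ζ y m * pderiv m (fun y => (G y)⁻¹ i k) y) x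
        (coordVec k) _ :=
      .sum fun m _ => .mul ((hdζ m).hasDirDeriv _) ((hpW i k m).hasDirDeriv _)
    have r : HasDirDeriv (fun x => -2 * ψ x * (G x)⁻¹ i k
      + ∑ j, ((G x)⁻¹ i j * pderiv j (fun y => ζ y k) x
        + (G x)⁻¹ j k * pderiv j (fun y => ζ y i) x)) x (coordVec k) _ :=
      .add (.mul (.const_mul (-2) ((hψ.diffAt h.isOpen hx).hasDirDeriv _))
        ((h.smooth_entry i k hx).hasDirDeriv _))
        (.sum fun j _ => .add
          (.mul ((h.smooth_entry i j hx).hasDirDeriv _) ((hpζ k j).hasDirDeriv _))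
          (.mul ((h.smooth_entry j k hx).hasDirDeriv _) ((hpζ i j).hasDirDeriv _)))
    have ev : (fun y => ∑ m, ζ y m * pderiv m (fun y => (G y)⁻¹ i k) y) =ᶠ[nhds x]
        (fun x => -2 * ψ x * (G x)⁻¹ i k
          + ∑ j, ((G x)⁻¹ i j * pderiv j (fun y => ζ y k) x
            + (G x)⁻¹ j k * pderiv j (fun y => ζ y i) x)) := by
      filter_upwards [h.isOpen.mem_nhds hx] with y hy
      exact h.sum_mul_pderiv_inv hL hy i k
    have := l.eq
    rw [ev.fderiv_eq, r.eq] at this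
    exact this.symm
  have lhs : ∑ k, fderiv ℝ (pderiv k (fun y => (G y)⁻¹ i k)) x (ζ x)
      = ∑ k, ∑ m, (pderiv k (fun y => ζ y m) x * pderiv m (fun y => (G y)⁻¹ i k) x
          + ζ x m * pderiv k (pderiv m (fun y => (G y)⁻¹ i k)) x)
        - ∑ k, ∑ m, pderiv k (fun y => ζ y m) x * pderiv m (fun y => (G y)⁻¹ i k) x := by
    simp only [Finset.sum_add_distrib, add_sub_cancel_left]
    refine Finset.sum_congr rfl fun k _ => ?_
    rw [fderiv_eq_sum_pderiv]
    exact Finset.sum_congr rfl fun m _ => by rw [pderiv_comm h.isOpen (h.smooth_inv i k) hx]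
  -- This commutator term cancels against an equal term from the right-hand side of `key`.
  have c1 : ∑ k, ∑ m, pderiv k (fun y => ζ y m) x * pderiv m (fun y => (G y)⁻¹ i k) x
      = ∑ k, ∑ j, pderiv k (fun y => (G y)⁻¹ i j) x * pderiv j (fun y => ζ y k) x := by
    rw [Finset.sum_comm]; simp only [mul_comm]
  have c2 : ∑ k, ∑ j, (G x)⁻¹ i j * pderiv k (pderiv j (fun y => ζ y k)) x
      = ∑ j, (G x)⁻¹ i j * ∑ k, pderiv j (pderiv k (fun y => ζ y k)) x := by
    rw [Finset.sum_comm]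
    simp only [Finset.mul_sum]
    exact Finset.sum_congr rfl fun j _ => Finset.sum_congr rfl fun k _ => by
      rw [pderiv_comm h.isOpen (hζ k) hx]
  have c3 : ∑ k, ∑ j, pderiv k (fun y => (G y)⁻¹ j k) x * pderiv j (fun y => ζ y i) x
      = ∑ j, (∑ k, pderiv k (fun y => (G y)⁻¹ j k) x) * pderiv j (fun y => ζ y i) x := by
    rw [Finset.sum_comm]; simp only [Finset.sum_mul]
  have c4 : ∑ k, ∑ j, (G x)⁻¹ j k * pderiv k (pderiv j (fun y => ζ y i)) x
      = ∑ j, ∑ k, (G x)⁻¹ j k * pderiv k (pderiv j (fun y => ζ y i)) x := Finset.sum_comm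
  have c5 : ∑ k, -2 * pderiv k ψ x * (G x)⁻¹ i k = -2 * ∑ k, (G x)⁻¹ i k * pderiv k ψ x := by
    rw [Finset.mul_sum]; exact Finset.sum_congr rfl fun k _ => by ring
  rw [lhs, Finset.sum_congr rfl fun k _ => key k, c1]
  simp only [Finset.sum_add_distrib]
  rw [c2, c3, c4, c5, ← Finset.mul_sum]
  ring

/-- Differentiate the trace identity `divergence_eq` in direction l. Closedness of `logVol` turns
ζ^m ∂_l into the derivative along ζ. -/
theorem fderiv_logVol {x : Coord n} (hx : x ∈ U) (l : Fin n) :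
    fderiv ℝ (logVol G l) x (ζ x) = n * pderiv l ψ x
      - ∑ k, pderiv l (pderiv k (fun y => ζ y k)) x
      - ∑ m, pderiv l (fun y => ζ y m) x * logVol G m x := by
  have hpζ : ∀ k m, DifferentiableAt ℝ (pderiv m (fun y => ζ y k)) x := fun k m =>
    (contDiffOn_pderiv h.isOpen (hζ k) m).diffAt h.isOpen hx
  have hdζ : ∀ k, DifferentiableAt ℝ (fun y => ζ y k) x := fun k => (hζ k).diffAt h.isOpen hx
  have e : HasDirDeriv (fun y => ∑ m, ζ y m * logVol G m y + ∑ a, pderiv a (fun y => ζ y a) y) x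
      (coordVec l) (∑ m, (pderiv l (fun y => ζ y m) x * logVol G m x
        + ζ x m * pderiv l (logVol G m) x) + ∑ a, pderiv l (pderiv a (fun y => ζ y a)) x) :=
    .add (.sum fun m _ => .mul ((hdζ m).hasDirDeriv _)
      (((h.smooth_logVol m).diffAt h.isOpen hx).hasDirDeriv _))
      (.sum fun a _ => (hpζ a a).hasDirDeriv _)
  have ev : (fun y => ∑ m, ζ y m * logVol G m y + ∑ a, pderiv a (fun y => ζ y a) y) =ᶠ[nhds x]
      fun y => (n : ℝ) * ψ y := by
    filter_upwards [h.isOpen.mem_nhds hx] with y hy using h.divergence_eq hy (hL y hy)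
  have e1 := e.eq
  rw [ev.fderiv_eq, (((hψ.diffAt h.isOpen hx).hasDirDeriv (coordVec l)).const_mul n).eq,
    Finset.sum_add_distrib] at e1
  have e2 : fderiv ℝ (logVol G l) x (ζ x) = ∑ m, ζ x m * pderiv l (logVol G m) x := by
    rw [fderiv_eq_sum_pderiv]
    exact Finset.sum_congr rfl fun m _ => by rw [h.pderiv_logVol_comm hx]
  rw [e2]
  have e3 : pderiv l ψ x = fderiv ℝ ψ x (coordVec l) := rfl
  rw [e3]
  linarith

/-- The contracted Lie derivative of the Christoffel symbols along a conformal Killing vector. -/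
theorem fderiv_gam {x : Coord n} (hx : x ∈ U) (i : Fin n) :
    fderiv ℝ (gam G i) x (ζ x) = (2 - n) * ∑ j, (G x)⁻¹ i j * pderiv j ψ x
      - 2 * ψ x * gam G i x + ∑ j, gam G j x * pderiv j (fun y => ζ y i) x
      - ∑ j, ∑ k, (G x)⁻¹ j k * pderiv k (pderiv j (fun y => ζ y i)) x := by
  have hpW : ∀ a b m, DifferentiableAt ℝ (pderiv m (fun y => (G y)⁻¹ a b)) x := fun a b m =>
    (contDiffOn_pderiv h.isOpen (h.smooth_inv a b) m).diffAt h.isOpen hx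
  have e1 : HasDirDeriv (fun x => - ∑ k, pderiv k (fun y => (G y)⁻¹ i k) x
      - ∑ l, (G x)⁻¹ i l * logVol G l x) x (ζ x)
      (- ∑ k, fderiv ℝ (pderiv k (fun y => (G y)⁻¹ i k)) x (ζ x)
        - ∑ l, (fderiv ℝ (fun y => (G y)⁻¹ i l) x (ζ x) * logVol G l x
          + (G x)⁻¹ i l * fderiv ℝ (logVol G l) x (ζ x))) :=
    .sub (.neg (.sum fun k _ => (hpW i k k).hasDirDeriv _))
      (.sum fun l _ => .mul ((h.smooth_entry i l hx).hasDirDeriv _)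
        (((h.smooth_logVol l).diffAt h.isOpen hx).hasDirDeriv _))
  have ev : gam G i =ᶠ[nhds x] fun x => - ∑ k, pderiv k (fun y => (G y)⁻¹ i k) x
      - ∑ l, (G x)⁻¹ i l * logVol G l x := by
    filter_upwards [h.isOpen.mem_nhds hx] with y hy using h.gam_eq hy i
  have b1 : ∑ l, fderiv ℝ (fun y => (G y)⁻¹ i l) x (ζ x) * logVol G l x
      = -2 * ψ x * ∑ l, (G x)⁻¹ i l * logVol G l x
        + ∑ l, (G x)⁻¹ i l * ∑ m, pderiv l (fun y => ζ y m) x * logVol G m x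
        + ∑ j, (∑ l, (G x)⁻¹ j l * logVol G l x) * pderiv j (fun y => ζ y i) x := by
    have c1 : ∑ l, (G x)⁻¹ i l * ∑ m, pderiv l (fun y => ζ y m) x * logVol G m x
        = ∑ l, ∑ j, (G x)⁻¹ i j * pderiv j (fun y => ζ y l) x * logVol G l x := by
      simp only [Finset.mul_sum]
      rw [Finset.sum_comm]; simp only [mul_assoc]
    have c2 : ∑ j, (∑ l, (G x)⁻¹ j l * logVol G l x) * pderiv j (fun y => ζ y i) x
        = ∑ l, ∑ j, (G x)⁻¹ j l * pderiv j (fun y => ζ y i) x * logVol G l x := by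
      simp only [Finset.sum_mul]
      rw [Finset.sum_comm]
      exact Finset.sum_congr rfl fun l _ => Finset.sum_congr rfl fun j _ => by ring
    rw [c1, c2, Finset.mul_sum, ← Finset.sum_add_distrib, ← Finset.sum_add_distrib]
    refine Finset.sum_congr rfl fun l _ => ?_
    rw [fderiv_eq_sum_pderiv, h.sum_mul_pderiv_inv hL hx, add_mul, Finset.sum_mul,
      add_assoc, ← Finset.sum_add_distrib]
    congr 1
    · ring
    · exact Finset.sum_congr rfl fun j _ => by ring
  have b2 : ∑ l, (G x)⁻¹ i l * fderiv ℝ (logVol G l) x (ζ x)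
      = n * ∑ l, (G x)⁻¹ i l * pderiv l ψ x
        - ∑ l, (G x)⁻¹ i l * ∑ k, pderiv l (pderiv k (fun y => ζ y k)) x
        - ∑ l, (G x)⁻¹ i l * ∑ m, pderiv l (fun y => ζ y m) x * logVol G m x := by
    rw [Finset.mul_sum, ← Finset.sum_sub_distrib, ← Finset.sum_sub_distrib]
    exact Finset.sum_congr rfl fun l _ => by rw [h.fderiv_logVol hζ hψ hL hx]; ring
  have b3 : ∑ j, gam G j x * pderiv j (fun y => ζ y i) x
      = - ∑ j, (∑ k, pderiv k (fun y => (G y)⁻¹ j k) x) * pderiv j (fun y => ζ y i) x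
        - ∑ j, (∑ l, (G x)⁻¹ j l * logVol G l x) * pderiv j (fun y => ζ y i) x := by
    rw [← Finset.sum_neg_distrib, ← Finset.sum_sub_distrib]
    exact Finset.sum_congr rfl fun j _ => by rw [h.gam_eq hx]; ring
  -- In the factor 2 - n, the 2 comes from the divergence of -2ψ g^ik and the -n from the trace. The
  -- gradients of the divergence of ζ cancel between the two.
  rw [ev.fderiv_eq, e1.eq, Finset.sum_add_distrib, b1, b2, b3, h.gam_eq hx,
    h.sum_fderiv_pderiv_inv hζ hψ hL hx]
  ring

end IsLocalMetric

end

section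

variable {n : ℕ}

/-! ### Slices of functions of `(x, u)` -/

theorem hasFDerivAt_slice (x : Coord n) (u : ℝ) :
    HasFDerivAt (fun y : Coord n => (y, u)) (ContinuousLinearMap.inl ℝ (Coord n) ℝ) x :=
  hasFDerivAt_prodMk_left x u

theorem dx_eq_pderiv {F : Coord n × ℝ → ℝ} {x : Coord n} {u : ℝ}
    (hF : DifferentiableAt ℝ F (x, u)) (i : Fin n) :
    dx i F (x, u) = pderiv i (fun y => F (y, u)) x := by
  have := (hF.hasFDerivAt.comp x (hasFDerivAt_slice x u)).fderiv
  unfold pderiv dx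
  erw [this]
  rfl

theorem hasDerivAt_slice {F : Coord n × ℝ → ℝ} {x : Coord n} {u : ℝ}
    (hF : DifferentiableAt ℝ F (x, u)) : HasDerivAt (fun t => F (x, t)) (du F (x, u)) u := by
  have h1 : HasDerivAt (fun t : ℝ => (x, t)) ((0 : Coord n), (1 : ℝ)) u :=
    (hasDerivAt_const u x).prodMk (hasDerivAt_id u)
  exact hF.hasFDerivAt.comp_hasDerivAt u h1

theorem pderiv_congr {U : Set (Coord n)} (hU : IsOpen U) {f g : Coord n → ℝ}
    (hfg : ∀ y ∈ U, f y = g y) {x : Coord n} (hx : x ∈ U) (i : Fin n) :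
    pderiv i f x = pderiv i g x := by
  have : f =ᶠ[nhds x] g := by filter_upwards [hU.mem_nhds hx] with y hy using hfg y hy
  simp only [pderiv, this.fderiv_eq]

section
variable {U : Set (Coord n)} (hU : IsOpen U) {F : Coord n × ℝ → ℝ}
  (hF : ContDiffOn ℝ ∞ F (U ×ˢ Set.univ))
include hU hF

theorem dx_of_slice {u : ℝ} {f : Coord n → ℝ} (hf : ∀ y ∈ U, F (y, u) = f y)
    {x : Coord n} (hx : x ∈ U) (i : Fin n) : dx i F (x, u) = pderiv i f x := by
  rw [dx_eq_pderiv (hF.diffAt (hU.prod isOpen_univ) (by simpa using hx))]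
  exact pderiv_congr hU hf hx i

theorem dx_dx_of_slice {u : ℝ} {f : Coord n → ℝ} (hf : ∀ y ∈ U, F (y, u) = f y)
    {x : Coord n} (hx : x ∈ U) (i j : Fin n) :
    dx j (dx i F) (x, u) = pderiv j (pderiv i f) x :=
  dx_of_slice hU (contDiffOn_dx hU hF i) (fun _ hy => dx_of_slice hU hF hf hy i) hx j

/-- A function whose `u`-derivative vanishes does not depend on `u`. -/
theorem eq_of_du_eq_zero {x : Coord n} (hx : x ∈ U) (h0 : ∀ u, du F (x, u) = 0) (u : ℝ) :
    F (x, u) = F (x, 0) := by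
  have hd : ∀ t, HasDerivAt (fun t => F (x, t)) (du F (x, t)) t := fun t =>
    hasDerivAt_slice (hF.diffAt (hU.prod isOpen_univ) (by simpa using hx))
  exact is_const_of_deriv_eq_zero (fun t => (hd t).differentiableAt)
    (fun t => by rw [(hd t).deriv, h0]) u 0

/-- A function whose second `u`-derivative vanishes is affine in `u`. -/
theorem eq_affine_of_du_du_eq_zero {x : Coord n} (hx : x ∈ U) (h0 : ∀ u, du (du F) (x, u) = 0)
    (u : ℝ) : F (x, u) = du F (x, 0) * u + F (x, 0) := by
  have hc := eq_of_du_eq_zero hU (contDiffOn_du hU hF) hx h0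
  -- Subtracting the candidate linear part leaves a function with zero derivative.
  have hd : ∀ t, HasDerivAt (fun t => F (x, t) - du F (x, 0) * t)
      (du F (x, t) - du F (x, 0) * 1) t := fun t =>
    (hasDerivAt_slice (hF.diffAt (hU.prod isOpen_univ) (by simpa using hx))).sub
      ((hasDerivAt_id t).const_mul _)
  have := is_const_of_deriv_eq_zero (fun t => (hd t).differentiableAt)
    (fun t => by rw [(hd t).deriv, hc t]; ring) u 0
  simp only [mul_zero, sub_zero] at this
  linarith

end

/-! ### The symmetry condition in local coordinates -/

theorem laplace_eq (G : Coord n → Matrix (Fin n) (Fin n) ℝ) (f : Coord n → ℝ) (x : Coord n) :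
    laplace G f x = ∑ i, ∑ j, (G x)⁻¹ i j * pderiv j (pderiv i f) x
      - ∑ i, gam G i x * pderiv i f x := rfl

section
variable {U : Set (Coord n)} {G : Coord n → Matrix (Fin n) (Fin n) ℝ} (h : IsLocalMetric U G)
  {V : Coord n → ℝ} (hV : ContDiffOn ℝ ∞ V U) {ξ : Coord n × ℝ → Coord n} {η : Coord n × ℝ → ℝ}
  (hξ : ∀ k, ContDiffOn ℝ ∞ (fun y => ξ y k) (U ×ˢ Set.univ))
  (hη : ContDiffOn ℝ ∞ η (U ×ˢ Set.univ))
include h hV hξ hη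

/-- The prolonged derivative for a projectable vector field that is affine in `u` and whose
projection is a conformal Killing vector. -/
theorem prolongedDeriv_of_conformalKilling {ζ : Coord n → Coord n} {a b ψ : Coord n → ℝ}
    (hξζ : ∀ x ∈ U, ∀ u, ξ (x, u) = ζ x) (hab : ∀ x ∈ U, ∀ u, η (x, u) = a x * u + b x)
    (ha : ContDiffOn ℝ ∞ a U) (hb : ContDiffOn ℝ ∞ b U) (hψ : ContDiffOn ℝ ∞ ψ U)
    (hL : ∀ x ∈ U, ∀ i j, lieDerivMetric G ζ x i j = 2 * ψ x * G x i j)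
    {x : Coord n} (hx : x ∈ U) (u : ℝ) (p : Fin n → ℝ) {q : Fin n → Fin n → ℝ}
    (hq : ∀ i j, q i j = q j i) :
    prolongedDeriv ξ η (kleinGordonJet G V) (x, u, p, q) =
      (a x - 2 * ψ x) * kleinGordonJet G V (x, u, p, q)
      + ∑ i, (∑ j, (G x)⁻¹ i j * (2 * pderiv j a x - (2 - n) * pderiv j ψ x)) * p i
      + u * (laplace G a x - ∑ k, ζ x k * pderiv k V x - 2 * ψ x * V x)
      + (laplace G b x - V x * b x) := by
  have hU := h.isOpen
  have hζ : ∀ k, ContDiffOn ℝ ∞ (fun y => ζ y k) U := fun k => by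
    have : ContDiffOn ℝ ∞ (fun y : Coord n => ξ (y, 0) k) U :=
      (hξ k).comp (contDiffOn_id.prodMk contDiffOn_const) (fun y hy => ⟨hy, Set.mem_univ _⟩)
    exact this.congr fun y hy => by simp only [hξζ y hy]
  have hdu : ∀ y ∈ U, ∀ t, du η (y, t) = a y := fun y hy t => by
    have h1 := hasDerivAt_slice (hη.diffAt (hU.prod isOpen_univ) (show (y, t) ∈ _ by simpa using hy))
    have h2 : HasDerivAt (fun t => a y * t + b y) (a y * 1) t :=
      ((hasDerivAt_id t).const_mul _).add_const _
    rw [funext (hab y hy)] at h1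
    simpa using h1.unique h2
  have hdudu : du (du η) (x, u) = 0 := by
    have h1 := hasDerivAt_slice ((contDiffOn_du hU hη).diffAt (hU.prod isOpen_univ)
      (show (x, u) ∈ _ by simpa using hx))
    rw [funext (hdu x hx)] at h1
    exact h1.unique (hasDerivAt_const _ _)
  have hduξ : ∀ y ∈ U, ∀ t k, du (fun y => ξ y k) (y, t) = 0 := fun y hy t k => by
    have h1 := hasDerivAt_slice ((hξ k).diffAt (hU.prod isOpen_univ)
      (show (y, t) ∈ _ by simpa using hy))
    simp only [hξζ y hy] at h1
    exact h1.unique (hasDerivAt_const _ _)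
  have hdxξ : ∀ j k, dx j (fun y => ξ y k) (x, u) = pderiv j (fun y => ζ y k) x := fun j k =>
    dx_of_slice hU (hξ k) (fun y hy => by rw [hξζ y hy]) hx j
  have hdxdxξ : ∀ i j k, dx j (dx i (fun y => ξ y k)) (x, u)
      = pderiv j (pderiv i (fun y => ζ y k)) x := fun i j k =>
    dx_dx_of_slice hU (hξ k) (fun y hy => by rw [hξζ y hy]) hx i j
  have hdxdu : ∀ j, dx j (du η) (x, u) = pderiv j a x := fun j =>
    dx_of_slice hU (contDiffOn_du hU hη) (fun y hy => hdu y hy u) hx j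
  have hpab : ∀ y ∈ U, ∀ i, pderiv i (fun y => a y * u + b y) y = u * pderiv i a y + pderiv i b y :=
    fun y hy i => by
      have e : HasDirDeriv (fun y => u * a y + b y) y (coordVec i) (u * pderiv i a y + pderiv i b y) :=
        .add (.const_mul u ((ha.diffAt hU hy).hasDirDeriv _)) ((hb.diffAt hU hy).hasDirDeriv _)
      simp only [mul_comm (a _) u]
      exact e.eq
  have hdxη : ∀ i, dx i η (x, u) = u * pderiv i a x + pderiv i b x := fun i => by
    rw [dx_of_slice hU hη (fun y hy => hab y hy u) hx i, hpab x hx]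
  have hdxdxη : ∀ i j, dx j (dx i η) (x, u)
      = u * pderiv j (pderiv i a) x + pderiv j (pderiv i b) x := fun i j => by
    rw [dx_dx_of_slice hU hη (fun y hy => hab y hy u) hx i j,
      pderiv_congr hU (fun y hy => hpab y hy i) hx]
    exact HasDirDeriv.eq (.add (.const_mul u
      (((contDiffOn_pderiv hU ha i).diffAt hU hx).hasDirDeriv _))
      (((contDiffOn_pderiv hU hb i).diffAt hU hx).hasDirDeriv _))
  have hA := (h.lieDerivMetric_iff ζ hx (ψ x)).1 (hL x hx)
  have hΓ := h.fderiv_gam hζ hψ hL hx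
  rw [prolongedDeriv_affine h hV hξ hη hx u p hq, prolongedDeriv_zero h hV hξ hη hduξ hx u p]
  simp only [hdudu, hduξ x hx, hdxξ, hdxdxξ, hdxdu, hdxη, hdxdxη, hdu x hx, hξζ x hx, hab x hx,
    mul_zero, Finset.sum_const_zero, sub_zero, add_zero, zero_mul, zero_add]
  have e1 : ∑ c, ∑ d, (fderiv ℝ (fun y => (G y)⁻¹ c d) x (ζ x) + a x * (G x)⁻¹ c d
      - ∑ j, ((G x)⁻¹ c j * pderiv j (fun y => ζ y d) x
        + (G x)⁻¹ d j * pderiv j (fun y => ζ y c) x)) * q c d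
      = (a x - 2 * ψ x) * ∑ c, ∑ d, (G x)⁻¹ c d * q c d := by
    simp only [Finset.mul_sum]
    refine Finset.sum_congr rfl fun c _ => Finset.sum_congr rfl fun d _ => ?_
    rw [add_sub_right_comm, hA]; ring
  -- By `fderiv_gam` the second derivatives of ζ and the Γ^j ζ^i_,j terms cancel. The surviving Γ^i
  -- has factor -(a - 2ψ), as the multiple of H requires.
  have e2 : ∑ i, (2 * ∑ j, (G x)⁻¹ i j * pderiv j a x
      - ∑ j, ∑ k, (G x)⁻¹ j k * pderiv k (pderiv j (fun y => ζ y i)) x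
      - fderiv ℝ (gam G i) x (ζ x) - gam G i x * a x
      + ∑ j, gam G j x * pderiv j (fun y => ζ y i) x) * p i
      = ∑ i, (∑ j, (G x)⁻¹ i j * (2 * pderiv j a x - (2 - n) * pderiv j ψ x)) * p i
        - (a x - 2 * ψ x) * ∑ i, gam G i x * p i := by
    rw [Finset.mul_sum, ← Finset.sum_sub_distrib]
    refine Finset.sum_congr rfl fun i _ => ?_
    have : ∑ j, (G x)⁻¹ i j * (2 * pderiv j a x - (2 - n) * pderiv j ψ x)
        = 2 * ∑ j, (G x)⁻¹ i j * pderiv j a x - (2 - n) * ∑ j, (G x)⁻¹ i j * pderiv j ψ x := by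
      rw [Finset.mul_sum, Finset.mul_sum, ← Finset.sum_sub_distrib]
      exact Finset.sum_congr rfl fun j _ => by ring
    rw [hΓ, this]; ring
  have e3 : ∑ i, ∑ j, (G x)⁻¹ i j * (u * pderiv j (pderiv i a) x + pderiv j (pderiv i b) x)
      = u * ∑ i, ∑ j, (G x)⁻¹ i j * pderiv j (pderiv i a) x
        + ∑ i, ∑ j, (G x)⁻¹ i j * pderiv j (pderiv i b) x := by
    simp only [Finset.mul_sum, ← Finset.sum_add_distrib]
    exact Finset.sum_congr rfl fun i _ => Finset.sum_congr rfl fun j _ => by ring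
  have e4 : ∑ i, gam G i x * (u * pderiv i a x + pderiv i b x)
      = u * ∑ i, gam G i x * pderiv i a x + ∑ i, gam G i x * pderiv i b x := by
    simp only [Finset.mul_sum, ← Finset.sum_add_distrib]
    exact Finset.sum_congr rfl fun i _ => by ring
  rw [e1, e2, e3, e4, laplace_eq, laplace_eq, kleinGordonJet_eq, fderiv_eq_sum_pderiv]
  ring

/-! ### Consequences of the symmetry condition in one chart. -/

variable (hn : 2 ≤ n) (hS : ∀ x ∈ U, ∀ (u : ℝ) (p : Fin n → ℝ) (q : Fin n → Fin n → ℝ),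
  (∀ i j, q i j = q j i) → kleinGordonJet G V (x, u, p, q) = 0 →
    prolongedDeriv ξ η (kleinGordonJet G V) (x, u, p, q) = 0)
include hn hS

/-- For fixed `(x, u, p)` this is `exists_multiplier` in the variable `q`. The multiplier may depend
on all three. -/
theorem exists_symmetry_multiplier {x : Coord n} (hx : x ∈ U) (u : ℝ) (p : Fin n → ℝ) :
    ∃ μ : ℝ, (∀ a b, fderiv ℝ (fun y => (G y)⁻¹ a b) x (ξ (x, u))
        + (du η (x, u) - ∑ k, p k * du (fun y => ξ y k) (x, u)) * (G x)⁻¹ a b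
        - ∑ j, ((G x)⁻¹ a j * (dx j (fun y => ξ y b) (x, u) + p j * du (fun y => ξ y b) (x, u))
          + (G x)⁻¹ b j * (dx j (fun y => ξ y a) (x, u) + p j * du (fun y => ξ y a) (x, u)))
        = μ * (G x)⁻¹ a b) ∧
      prolongedDeriv ξ η (kleinGordonJet G V) (x, u, p, 0)
        = - μ * (∑ i, gam G i x * p i + V x * u) := by
  have hd : ∀ a b v, fderiv ℝ (fun y => (G y)⁻¹ a b) x v
      = fderiv ℝ (fun y => (G y)⁻¹ b a) x v := fun a b v => by
    have : (fun y => (G y)⁻¹ a b) =ᶠ[nhds x] fun y => (G y)⁻¹ b a := by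
      filter_upwards [h.isOpen.mem_nhds hx] with y hy using h.symm_inv hy a b
    rw [this.fderiv_eq]
  refine exists_multiplier (h.inv_ne_zero (by omega) hx) (h.symm_inv hx) (fun a b => ?_)
    fun q hq hc => ?_
  · rw [hd, h.symm_inv hx a b]
    congr 1
    exact Finset.sum_congr rfl fun j _ => add_comm _ _
  · rw [← prolongedDeriv_affine h hV hξ hη hx u p hq]
    refine hS x hx u p q hq ?_
    rw [kleinGordonJet_eq]
    simp only
    rw [hc]; ring

theorem du_field_eq_zero {x : Coord n} (hx : x ∈ U) (u : ℝ) (k : Fin n) :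
    du (fun y => ξ y k) (x, u) = 0 := by
  set w : Fin n → ℝ := fun k => du (fun y => ξ y k) (x, u) with hw
  obtain ⟨μ₀, h0, -⟩ := exists_symmetry_multiplier h hV hξ hη hn hS hx u 0
  -- Lowering the index of `w` makes g^aj p_j = w^a, so the terms linear in `p` become 2 w^a w^b.
  -- Subtracting the relation at `p = 0` leaves w^a w^b proportional to g^ab.
  set p : Fin n → ℝ := fun i => ∑ c, G x i c * w c with hp
  obtain ⟨μ₁, h1, -⟩ := exists_symmetry_multiplier h hV hξ hη hn hS hx u p
  have hWp : ∀ a, ∑ j, (G x)⁻¹ a j * p j = w a := fun a => by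
    have := congrFun (congrArg (fun A => Matrix.mulVec A w) (h.inv_mul hx)) a
    rw [← Matrix.mulVec_mulVec, Matrix.one_mulVec] at this
    exact this
  have key : ∀ a b, w a * w b = ((μ₀ - μ₁ - ∑ k, p k * w k) / 2) * (G x)⁻¹ a b := fun a b => by
    have e0 := h0 a b
    have e1 := h1 a b
    have e2 : ∑ j, ((G x)⁻¹ a j * (dx j (fun y => ξ y b) (x, u) + p j * w b)
          + (G x)⁻¹ b j * (dx j (fun y => ξ y a) (x, u) + p j * w a))
        = ∑ j, ((G x)⁻¹ a j * dx j (fun y => ξ y b) (x, u)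
          + (G x)⁻¹ b j * dx j (fun y => ξ y a) (x, u)) + 2 * (w a * w b) := by
      have : 2 * (w a * w b) = ∑ j, ((G x)⁻¹ a j * p j * w b + (G x)⁻¹ b j * p j * w a) := by
        rw [Finset.sum_add_distrib, ← Finset.sum_mul, ← Finset.sum_mul, hWp, hWp]; ring
      rw [this, ← Finset.sum_add_distrib]
      exact Finset.sum_congr rfl fun j _ => by ring
    simp only [Pi.zero_apply, zero_mul, Finset.sum_const_zero, sub_zero, add_zero] at e0
    change _ + (_ - ∑ k, p k * w k) * _ - ∑ j, (_ * (_ + p j * w b) + _ * (_ + p j * w a)) = _ at e1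
    rw [e2] at e1
    linarith
  exact congrFun (eq_zero_of_mul_eq (Matrix.isUnit_nonsing_inv_det _ (h.isUnit x hx)) hn key) k

/-- The leading relation no longer contains `p`, so the multiplier is constant in `p` and the value
at `q = 0` is affine in `p`. Its quadratic part, a multiple of the nonzero form g^ij, must therefore
vanish. -/
theorem du_du_eq_zero {x : Coord n} (hx : x ∈ U) (u : ℝ) : du (du η) (x, u) = 0 := by
  have hu : ∀ x ∈ U, ∀ u k, du (fun y => ξ y k) (x, u) = 0 := fun x hx u k =>
    du_field_eq_zero h hV hξ hη hn hS hx u k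
  choose μ hμ hμ' using exists_symmetry_multiplier h hV hξ hη hn hS hx u
  obtain ⟨c, d, hcd⟩ := h.inv_ne_zero (by omega) hx
  have hμc : ∀ p, μ p = μ 0 := fun p => by
    have e1 := hμ p c d
    have e0 := hμ 0 c d
    simp only [hu x hx, mul_zero, Finset.sum_const_zero, add_zero] at e0 e1
    exact mul_right_cancel₀ hcd (e1.symm.trans e0)
  by_contra hne
  refine hcd (eq_zero_of_quadratic (h.symm_inv hx) (fun p => ?_) c d)
  -- Combining the values at `p`, `-p` and `0` isolates the quadratic part.
  have hp := hμ' p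
  have hm := hμ' (-p)
  have h0 := hμ' 0
  rw [hμc, prolongedDeriv_zero h hV hξ hη hu hx] at hp hm
  rw [prolongedDeriv_zero h hV hξ hη hu hx] at h0
  simp only [Pi.neg_apply, mul_neg, neg_mul, neg_neg, Finset.sum_neg_distrib, Pi.zero_apply,
    mul_zero, Finset.sum_const_zero, zero_add] at hp hm h0
  have : du (du η) (x, u) * ∑ i, ∑ j, (G x)⁻¹ i j * (p i * p j) = 0 := by linarith
  exact (mul_eq_zero.1 this).resolve_left hne

theorem exists_conformalFactor :
    ∃ ψ : Coord n → ℝ, ContDiffOn ℝ ∞ ψ U ∧ ∀ x ∈ U, ∀ i j,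
      lieDerivMetric G (fun y => ξ (y, 0)) x i j = 2 * ψ x * G x i j := by
  have hU := h.isOpen
  have hu : ∀ x ∈ U, ∀ u k, du (fun y => ξ y k) (x, u) = 0 := fun x hx u k =>
    du_field_eq_zero h hV hξ hη hn hS hx u k
  have hex : ∀ x ∈ U, ∃ c : ℝ, ∀ i j,
      lieDerivMetric G (fun y => ξ (y, 0)) x i j = 2 * c * G x i j := fun x hx => by
    obtain ⟨μ, hμ, -⟩ := exists_symmetry_multiplier h hV hξ hη hn hS hx 0 0
    refine ⟨(du η (x, 0) - μ) / 2, (h.lieDerivMetric_iff _ hx _).2 fun a b => ?_⟩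
    have e := hμ a b
    have hdx : ∀ j k, dx j (fun y => ξ y k) (x, 0) = pderiv j (fun y => ξ (y, 0) k) x := fun j k =>
      dx_of_slice hU (hξ k) (fun y _ => rfl) hx j
    simp only [hdx, Pi.zero_apply, zero_mul, Finset.sum_const_zero, sub_zero, add_zero] at e
    linarith
  have hζ : ∀ k, ContDiffOn ℝ ∞ (fun y : Coord n => ξ (y, 0) k) U := fun k =>
    (hξ k).comp (contDiffOn_id.prodMk contDiffOn_const) (fun y hy => ⟨hy, Set.mem_univ _⟩)
  -- The pointwise factor comes from a multiplier with no known regularity. The trace identity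
  -- rewrites it as a visibly smooth expression.
  refine ⟨fun x => (n : ℝ)⁻¹ * (∑ m, ξ (x, 0) m * logVol G m x
    + ∑ a, pderiv a (fun y => ξ (y, 0) a) x), ?_, fun x hx => ?_⟩
  · exact contDiffOn_const.mul ((ContDiffOn.sum fun m _ => (hζ m).mul (h.smooth_logVol m)).add
      (ContDiffOn.sum fun a _ => contDiffOn_pderiv hU (hζ a) a))
  · obtain ⟨c, hc⟩ := hex x hx
    have e := h.divergence_eq hx hc
    have hn0 : (n : ℝ) ≠ 0 := by positivity
    simp only [e, inv_mul_cancel_left₀ hn0]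
    exact hc

/-- The determining equations of the Lie point symmetries, for a given conformal factor. -/
theorem determining_equations {a b ψ : Coord n → ℝ} {ζ : Coord n → Coord n}
    (hξζ : ∀ x ∈ U, ∀ u, ξ (x, u) = ζ x) (hab : ∀ x ∈ U, ∀ u, η (x, u) = a x * u + b x)
    (ha : ContDiffOn ℝ ∞ a U) (hb : ContDiffOn ℝ ∞ b U) (hψ : ContDiffOn ℝ ∞ ψ U)
    (hL : ∀ x ∈ U, ∀ i j, lieDerivMetric G ζ x i j = 2 * ψ x * G x i j)
    {x : Coord n} (hx : x ∈ U) :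
    (∀ j, 2 * pderiv j a x = (2 - n) * pderiv j ψ x) ∧
    laplace G a x - ∑ k, ζ x k * pderiv k V x - 2 * ψ x * V x = 0 ∧
    laplace G b x = V x * b x := by
  have hW := h.inv_ne_zero (by omega) hx
  have hs := sum_mul_self_pos hW
  have key : ∀ (u : ℝ) (p : Fin n → ℝ),
      ∑ i, (∑ j, (G x)⁻¹ i j * (2 * pderiv j a x - (2 - n) * pderiv j ψ x)) * p i
      + u * (laplace G a x - ∑ k, ζ x k * pderiv k V x - 2 * ψ x * V x)
      + (laplace G b x - V x * b x) = 0 := fun u p => by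
    -- For any `u` and `p`, this scale puts the jet with `q = t g⁻¹` on H = 0, where the multiple of
    -- H drops out.
    set t := (∑ i, gam G i x * p i + V x * u) / ∑ i, ∑ j, (G x)⁻¹ i j * (G x)⁻¹ i j with ht
    set q : Fin n → Fin n → ℝ := fun i j => t * (G x)⁻¹ i j with hqd
    have hq : ∀ i j, q i j = q j i := fun i j => by simp only [hqd, h.symm_inv hx i j]
    have hH : kleinGordonJet G V (x, u, p, q) = 0 := by
      have : ∑ i, ∑ j, (G x)⁻¹ i j * q i j = t * ∑ i, ∑ j, (G x)⁻¹ i j * (G x)⁻¹ i j := by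
        simp only [hqd, Finset.mul_sum]
        exact Finset.sum_congr rfl fun i _ => Finset.sum_congr rfl fun j _ => by ring
      rw [kleinGordonJet_eq]
      simp only
      rw [this, ht, div_mul_cancel₀ _ hs.ne']; ring
    have e := hS x hx u p q hq hH
    rw [prolongedDeriv_of_conformalKilling h hV hξ hη hξζ hab ha hb hψ hL hx u p hq, hH] at e
    linarith
  have k0 := key 0 0
  have k1 := key 1 0
  simp only [Pi.zero_apply, mul_zero, Finset.sum_const_zero, zero_add, zero_mul, one_mul] at k0 k1
  refine ⟨fun j => ?_, by linarith, by linarith⟩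
  have hvec : Matrix.mulVec (G x)⁻¹ (fun j => 2 * pderiv j a x - (2 - n) * pderiv j ψ x) = 0 := by
    ext i
    have := key 0 (Pi.single i 1)
    simp only [Pi.single_apply, mul_ite, mul_one, mul_zero, Finset.sum_ite_eq', Finset.mem_univ,
      if_true, zero_mul, add_zero, k0] at this
    exact this
  -- Multiplying by `G` strips the inverse metric from the gradient equation.
  have := congrArg (Matrix.mulVec (G x)) hvec
  rw [Matrix.mulVec_mulVec, h.mul_inv hx, Matrix.one_mulVec, Matrix.mulVec_zero] at this
  have := congrFun this j
  simp only [Pi.zero_apply] at this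
  linarith

end

end

section

variable {n : ℕ}

/-! ### Tensoriality of the Lie derivative of the metric -/

theorem matDeriv_mul {A B : Coord n → Matrix (Fin n) (Fin n) ℝ} {x : Coord n}
    (hA : ∀ i j, DifferentiableAt ℝ (fun y => A y i j) x)
    (hB : ∀ i j, DifferentiableAt ℝ (fun y => B y i j) x) (v : Coord n) :
    matDeriv (fun y => A y * B y) x v = matDeriv A x v * B x + A x * matDeriv B x v := by
  ext i j
  have e : HasDirDeriv (fun y => ∑ k, A y i k * B y k j) x v
      (∑ k, (fderiv ℝ (fun y => A y i k) x v * B x k j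
        + A x i k * fderiv ℝ (fun y => B y k j) x v)) :=
    .sum fun k _ => .mul ((hA i k).hasDirDeriv v) ((hB k j).hasDirDeriv v)
  simp only [Finset.sum_add_distrib] at e
  exact e.eq

theorem differentiableAt_matrix_mul {A B : Coord n → Matrix (Fin n) (Fin n) ℝ} {x : Coord n}
    (hA : ∀ i j, DifferentiableAt ℝ (fun y => A y i j) x)
    (hB : ∀ i j, DifferentiableAt ℝ (fun y => B y i j) x) (i j : Fin n) :
    DifferentiableAt ℝ (fun y => (A y * B y) i j) x := by
  simp only [Matrix.mul_apply]
  exact DifferentiableAt.fun_sum fun k _ => (hA i k).mul (hB k j)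

theorem fderiv_comp_coord {φ : Coord n → Coord n} {f : Coord n → ℝ} {x : Coord n}
    (hφ : DifferentiableAt ℝ φ x) (hf : DifferentiableAt ℝ f (φ x)) (v : Coord n) :
    fderiv ℝ (fun y => f (φ y)) x v = fderiv ℝ f (φ x) (fderiv ℝ φ x v) := by
  have := (hf.hasFDerivAt.comp x hφ.hasFDerivAt).fderiv
  erw [this]
  rfl

theorem fderiv_coord_apply {φ : Coord n → Coord n} {x : Coord n}
    (hφ : DifferentiableAt ℝ φ x) (v : Coord n) (a : Fin n) :
    fderiv ℝ (fun y => φ y a) x v = fderiv ℝ φ x v a := by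
  have := ((EuclideanSpace.proj a : Coord n →L[ℝ] ℝ).hasFDerivAt.comp x hφ.hasFDerivAt).fderiv
  have e : (fun y => φ y a) = (EuclideanSpace.proj a : Coord n →L[ℝ] ℝ) ∘ φ := rfl
  rw [e, this]
  rfl

theorem fderiv_apply_eq_mulVec {φ : Coord n → Coord n} {x : Coord n}
    (hφ : DifferentiableAt ℝ φ x) (v : Coord n) (a : Fin n) :
    fderiv ℝ φ x v a = ∑ k, jacobian φ x a k * v k := by
  rw [← fderiv_coord_apply hφ, fderiv_eq_sum_pderiv]
  exact Finset.sum_congr rfl fun k _ => mul_comm _ _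

/-- The Lie derivative of a metric is a tensor. -/
theorem lieDerivMetric_transform {O : Set (Coord n)} (hO : IsOpen O) {φ : Coord n → Coord n}
    (hφ : ContDiffOn ℝ ∞ φ O) {G G' : Coord n → Matrix (Fin n) (Fin n) ℝ}
    {ζ ζ' : Coord n → Coord n} {x : Coord n} (hx : x ∈ O)
    (hG : ∀ y ∈ O, G y = (jacobian φ y).transpose * G' (φ y) * jacobian φ y)
    (hζ : ∀ y ∈ O, ζ' (φ y) = fderiv ℝ φ y (ζ y))
    (hG' : ∀ i j, DifferentiableAt ℝ (fun y => G' y i j) (φ x))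
    (hζd : ∀ k, DifferentiableAt ℝ (fun y => ζ y k) x)
    (hζ' : ∀ k, DifferentiableAt ℝ (fun y => ζ' y k) (φ x)) :
    Matrix.of (lieDerivMetric G ζ x) = (jacobian φ x).transpose
      * Matrix.of (lieDerivMetric G' ζ' (φ x)) * jacobian φ x := by
  have hφd : ∀ y ∈ O, DifferentiableAt ℝ φ y := fun y hy =>
    (hφ.differentiableOn (by simp)).differentiableAt (hO.mem_nhds hy)
  have hφc : ∀ a, ContDiffOn ℝ ∞ (fun y => φ y a) O := fun a => contDiffOn_euclidean.1 hφ a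
  have hJd : ∀ a i, DifferentiableAt ℝ (fun y => jacobian φ y a i) x := fun a i =>
    (contDiffOn_pderiv hO (hφc a) i).diffAt hO hx
  have hGφ : ∀ i j, DifferentiableAt ℝ (fun y => G' (φ y) i j) x := fun i j =>
    (hG' i j).comp x (hφd x hx)
  have eL : ∀ (G : Coord n → Matrix (Fin n) (Fin n) ℝ) ζ x, Matrix.of (lieDerivMetric G ζ x) =
      matDeriv G x (ζ x) + (jacobian ζ x).transpose * G x + G x * jacobian ζ x := fun G ζ x => by
    ext i j; exact lieDerivMetric_eq G ζ x i j
  have e1 : matDeriv G x (ζ x)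
      = ((matDeriv (jacobian φ) x (ζ x)).transpose * G' (φ x)
        + (jacobian φ x).transpose * matDeriv G' (φ x) (ζ' (φ x))) * jacobian φ x
        + (jacobian φ x).transpose * G' (φ x) * matDeriv (jacobian φ) x (ζ x) := by
    have c1 : matDeriv G x (ζ x)
        = matDeriv (fun y => (jacobian φ y).transpose * G' (φ y) * jacobian φ y) x (ζ x) := by
      ext i j
      have : (fun y => G y i j) =ᶠ[nhds x]
          fun y => ((jacobian φ y).transpose * G' (φ y) * jacobian φ y) i j := by
        filter_upwards [hO.mem_nhds hx] with y hy
        rw [hG y hy]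
      simp only [matDeriv, Matrix.of_apply, this.fderiv_eq]
    have c2 : matDeriv (fun y => G' (φ y)) x (ζ x) = matDeriv G' (φ x) (ζ' (φ x)) := by
      ext i j
      simp only [matDeriv, Matrix.of_apply]
      rw [fderiv_comp_coord (f := fun y => G' y i j) (hφd x hx) (hG' i j), hζ x hx]
    have c3 : matDeriv (fun y => (jacobian φ y).transpose) x (ζ x)
        = (matDeriv (jacobian φ) x (ζ x)).transpose := rfl
    have hJt : ∀ i j, DifferentiableAt ℝ (fun y => (jacobian φ y).transpose i j) x :=
      fun i j => hJd j i
    rw [c1, matDeriv_mul (differentiableAt_matrix_mul hJt hGφ) hJd, matDeriv_mul hJt hGφ, c2, c3]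
  -- The derivative of ζ' ∘ φ = Jζ. Its second derivatives of φ are those occurring in `e1`, so they
  -- cancel from the Lie derivative.
  have e2 : jacobian ζ' (φ x) * jacobian φ x
      = matDeriv (jacobian φ) x (ζ x) + jacobian φ x * jacobian ζ x := by
    ext a i
    have l : fderiv ℝ (fun y => ζ' (φ y) a) x (coordVec i)
        = (jacobian ζ' (φ x) * jacobian φ x) a i := by
      rw [fderiv_comp_coord (f := fun y => ζ' y a) (hφd x hx) (hζ' a), fderiv_eq_sum_pderiv,
        Matrix.mul_apply]
      refine Finset.sum_congr rfl fun c _ => ?_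
      rw [← fderiv_coord_apply (hφd x hx), mul_comm]; rfl
    have r : HasDirDeriv (fun y => ∑ k, jacobian φ y a k * ζ y k) x (coordVec i)
        (∑ k, (pderiv i (pderiv k (fun y => φ y a)) x * ζ x k
          + jacobian φ x a k * pderiv i (fun y => ζ y k) x)) :=
      .sum fun k _ => .mul ((hJd a k).hasDirDeriv _) ((hζd k).hasDirDeriv _)
    have ev : (fun y => ζ' (φ y) a) =ᶠ[nhds x] fun y => ∑ k, jacobian φ y a k * ζ y k := by
      filter_upwards [hO.mem_nhds hx] with y hy
      rw [hζ y hy, fderiv_apply_eq_mulVec (hφd y hy)]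
    rw [← l, ev.fderiv_eq, r.eq, Finset.sum_add_distrib]
    simp only [Matrix.add_apply, matDeriv, Matrix.of_apply, Matrix.mul_apply]
    congr 1
    rw [fderiv_eq_sum_pderiv]
    refine Finset.sum_congr rfl fun k _ => ?_
    rw [pderiv_comm hO (hφc a) hx, mul_comm]; rfl
  have e3 := congrArg Matrix.transpose e2
  simp only [Matrix.transpose_mul, Matrix.transpose_add] at e3
  rw [eL, eL, e1, hG x hx]
  have e4 : (jacobian φ x).transpose * (matDeriv G' (φ x) (ζ' (φ x))
      + (jacobian ζ' (φ x)).transpose * G' (φ x) + G' (φ x) * jacobian ζ' (φ x)) * jacobian φ x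
      = (jacobian φ x).transpose * matDeriv G' (φ x) (ζ' (φ x)) * jacobian φ x
        + ((jacobian φ x).transpose * (jacobian ζ' (φ x)).transpose) * G' (φ x) * jacobian φ x
        + (jacobian φ x).transpose * G' (φ x) * (jacobian ζ' (φ x) * jacobian φ x) := by
    noncomm_ring
  rw [e4, e2, e3]
  noncomm_ring

end

section

variable {n : ℕ} {M : Type*} [TopologicalSpace M] [ChartedSpace (EuclideanSpace ℝ (Fin n)) M]

/-! ### Smoothness of components in charts -/

variable {e : OpenPartialHomeomorph M (EuclideanSpace ℝ (Fin n))}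

theorem inner_mfderiv_symm [IsManifold (𝓡 n) ∞ M] (g : PseudoRiemannianMetric n M) (x v w : Coord n) :
    g.inner (e.symm x) (mfderiv (𝓡 n) (𝓡 n) e.symm x v) (mfderiv (𝓡 n) (𝓡 n) e.symm x w)
      = ∑ i, ∑ j, v i * (w j * g.inChart e x i j) := by
  set L : Coord n →L[ℝ] TangentSpace (𝓡 n) (e.symm x) := mfderiv (𝓡 n) (𝓡 n) e.symm x
  have h1 : ∀ v : Coord n, L v = ∑ i, v i • L (coordVec i) := fun v => by
    conv_lhs => rw [sum_smul_coordVec v]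
    rw [map_sum]
    exact Finset.sum_congr rfl fun i _ => map_smul L _ _
  change g.inner (e.symm x) (L v) (L w) = _
  rw [h1 w, map_sum, Finset.sum_comm]
  refine Finset.sum_congr rfl fun j _ => ?_
  rw [map_smul, g.symm, h1 v, map_sum, Finset.smul_sum]
  refine Finset.sum_congr rfl fun i _ => ?_
  rw [map_smul, g.symm]
  change w j * (v i * g.inChart e x i j) = _
  ring

variable (he : e ∈ IsManifold.maximalAtlas (𝓡 n) ∞ M)
include he

theorem mdifferentiable_of_mem_maximalAtlas : e.MDifferentiable (𝓡 n) (𝓡 n) :=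
  ⟨(contMDiffOn_of_mem_maximalAtlas he).mdifferentiableOn (by simp),
    (contMDiffOn_symm_of_mem_maximalAtlas he).mdifferentiableOn (by simp)⟩

theorem contDiffOn_comp_symm {f : M → ℝ} (hf : ContMDiff (𝓡 n) 𝓘(ℝ, ℝ) ∞ f) :
    ContDiffOn ℝ ∞ (fun y => f (e.symm y)) e.target :=
  contMDiffOn_iff_contDiffOn.1
    (hf.comp_contMDiffOn (contMDiffOn_symm_of_mem_maximalAtlas he))

theorem contMDiffOn_prod_symm : ContMDiffOn 𝓘(ℝ, Coord n × ℝ) ((𝓡 n).prod 𝓘(ℝ, ℝ)) ∞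
    (fun z : Coord n × ℝ => (e.symm z.1, z.2)) (e.target ×ˢ Set.univ) :=
  ((contMDiffOn_symm_of_mem_maximalAtlas he).comp contDiff_fst.contMDiff.contMDiffOn
    fun _ hz => hz.1).prodMk contDiff_snd.contMDiff.contMDiffOn

theorem mfderiv_symm_vecInChart {x : Coord n} (hx : x ∈ e.target)
    (v : TangentSpace (𝓡 n) (e.symm x)) :
    mfderiv (𝓡 n) (𝓡 n) e.symm x (vecInChart e (e.symm x) v) = v := by
  have h := (mdifferentiable_of_mem_maximalAtlas he).symm_comp_deriv (e.map_target hx)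
  rw [e.right_inv hx] at h
  exact congrArg (fun L => L v) h

theorem fderiv_chart_change {e' : OpenPartialHomeomorph M (EuclideanSpace ℝ (Fin n))}
    (he' : e' ∈ IsManifold.maximalAtlas (𝓡 n) ∞ M) {x : Coord n} (hx : x ∈ e.target)
    (hx' : e.symm x ∈ e'.source)
    (v : Coord n) : fderiv ℝ (fun y => e' (e.symm y)) x v
      = vecInChart e' (e.symm x) (mfderiv (𝓡 n) (𝓡 n) e.symm x v) := by
  have h1 := mfderiv_comp x ((mdifferentiable_of_mem_maximalAtlas he').mdifferentiableAt hx')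
    ((mdifferentiable_of_mem_maximalAtlas he).mdifferentiableAt_symm hx)
  rw [mfderiv_eq_fderiv] at h1
  exact congrArg (fun L => L v) h1

theorem contDiffOn_chart_change {e' : OpenPartialHomeomorph M (EuclideanSpace ℝ (Fin n))}
    (he' : e' ∈ IsManifold.maximalAtlas (𝓡 n) ∞ M) :
    ContDiffOn ℝ ∞ (fun y => e' (e.symm y)) (e.target ∩ e.symm ⁻¹' e'.source) :=
  contMDiffOn_iff_contDiffOn.1 ((contMDiffOn_of_mem_maximalAtlas he').comp
    ((contMDiffOn_symm_of_mem_maximalAtlas he).mono Set.inter_subset_left) fun _ hx => hx.2)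

variable [IsManifold (𝓡 n) ∞ M]

/-- The tangent map of `e.symm` is smooth, and it is applied to a constant section. -/
theorem contMDiffOn_symm_mfderiv (v : Coord n) : ContMDiffOn (𝓡 n) (𝓡 n).tangent ∞
    (fun x => (⟨e.symm x, mfderiv (𝓡 n) (𝓡 n) e.symm x v⟩ : TangentBundle (𝓡 n) M)) e.target := by
  have : IsManifold (𝓡 n) 1 M := IsManifold.of_le (n := ∞) (by simp)
  have h1 := (contMDiffOn_symm_of_mem_maximalAtlas he).contMDiffOn_tangentMapWithin (m := ∞)
    (by simp) e.open_target.uniqueMDiffOn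
  have h2 : ContMDiffOn (𝓡 n) (𝓡 n).tangent ∞
      (fun x => (⟨x, v⟩ : TangentBundle (𝓡 n) (Coord n))) e.target :=
    contMDiffOn_vectorSpace_iff_contDiffOn.2 contDiffOn_const
  refine (h1.comp h2 fun x hx => hx).congr fun x hx => ?_
  simp [tangentMapWithin, mfderivWithin_of_isOpen e.open_target hx]

theorem PointVectorField.contDiffOn_η (X : PointVectorField n M) :
    ContDiffOn ℝ ∞ (fun z : Coord n × ℝ => X.η (e.symm z.1) z.2) (e.target ×ˢ Set.univ) :=
  contMDiffOn_iff_contDiffOn.1 (X.smooth_η.comp_contMDiffOn (contMDiffOn_prod_symm he))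

theorem PointVectorField.contDiffOn_ξ (X : PointVectorField n M) (k : Fin n) :
    ContDiffOn ℝ ∞ (fun z : Coord n × ℝ =>
      vecInChart e (e.symm z.1) (X.ξ (e.symm z.1) z.2) k) (e.target ×ˢ Set.univ) := by
  have : IsManifold (𝓡 n) 1 M := IsManifold.of_le (n := ∞) (by simp)
  have h1 := (contMDiffOn_of_mem_maximalAtlas he).contMDiffOn_tangentMapWithin (m := ∞)
    (by simp) e.open_source.uniqueMDiffOn
  have h2 := X.smooth_ξ.comp_contMDiffOn (contMDiffOn_prod_symm he)
  have h3 := (contMDiff_snd_tangentBundle_modelSpace (n := ∞) (Coord n) (𝓡 n)).comp_contMDiffOn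
    (h1.comp h2 fun z hz => e.map_target hz.1)
  have h4 := contMDiffOn_iff_contDiffOn.1 h3
  refine (contDiffOn_euclidean.1 h4 k).congr fun z hz => ?_
  rw [vecInChart, ← mfderivWithin_of_isOpen e.open_source (e.map_target hz.1)]
  rfl

theorem isLocalMetric_inChart (g : PseudoRiemannianMetric n M) :
    IsLocalMetric e.target (g.inChart e) where
  isOpen := e.open_target
  symm x _ i j := g.symm _ _ _
  smooth i j := by
    have hb := contMDiffOn_symm_of_mem_maximalAtlas he
    have : ContMDiffOn (𝓡 n) ((𝓡 n).prod 𝓘(ℝ, ℝ)) ∞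
        (fun x => Bundle.TotalSpace.mk' ℝ (E := Bundle.Trivial M ℝ) (e.symm x)
          (g.inner (e.symm x) (chartVec e x i) (chartVec e x j))) e.target :=
      ContMDiffOn.clm_bundle_apply₂ (F₁ := EuclideanSpace ℝ (Fin n))
        (F₂ := EuclideanSpace ℝ (Fin n)) (g.contMDiff.comp_contMDiffOn hb)
        (contMDiffOn_symm_mfderiv he (coordVec i)) (contMDiffOn_symm_mfderiv he (coordVec j))
    refine contMDiffOn_iff_contDiffOn.1 fun x hx => ?_
    have h1 := this x hx
    simp only [Bundle.contMDiffWithinAt_totalSpace] at h1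
    exact h1.2
  isUnit x hx := by
    rw [isUnit_iff_ne_zero]
    intro h0
    obtain ⟨v, hv, hv0⟩ := Matrix.exists_mulVec_eq_zero_iff.2 h0
    set w : Coord n := WithLp.toLp 2 v with hw
    set L := mfderiv (𝓡 n) (𝓡 n) e.symm x with hL
    have hLw : L w = 0 := by
      -- A kernel vector of the component matrix is orthogonal to every tangent vector, hence zero.
      refine g.nondegenerate _ _ fun t => ?_
      rw [← mfderiv_symm_vecInChart he hx t, g.symm, inner_mfderiv_symm]
      refine Finset.sum_eq_zero fun i _ => ?_
      have h1 : ∑ j, g.inChart e x i j * v j = 0 := congrFun hv0 i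
      rw [← Finset.mul_sum]
      simp only [mul_comm _ (g.inChart e x i _)]
      exact mul_eq_zero_of_right _ h1
    have hi : Function.Injective L :=
      (mdifferentiable_of_mem_maximalAtlas he).symm.mfderiv_injective hx
    have hw0 : w = 0 := hi (hLw.trans (map_zero L).symm)
    exact hv (by simpa [hw] using hw0)

end

section

variable {n : ℕ} {M : Type*} [TopologicalSpace M] [ChartedSpace (EuclideanSpace ℝ (Fin n)) M]
  [IsManifold (𝓡 n) ∞ M]

/-! ### Conformal factors do not depend on the chart -/

section ChartChange
variable {e e' : OpenPartialHomeomorph M (EuclideanSpace ℝ (Fin n))}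
  (he : e ∈ IsManifold.maximalAtlas (𝓡 n) ∞ M) (he' : e' ∈ IsManifold.maximalAtlas (𝓡 n) ∞ M)

include he in
theorem inner_eq_sum_vecInChart (g : PseudoRiemannianMetric n M) {p : M} (hp : p ∈ e.source)
    (v w : TangentSpace (𝓡 n) p) : g.inner p v w
      = ∑ i, ∑ j, vecInChart e p v i * (vecInChart e p w j * g.inChart e (e p) i j) := by
  obtain ⟨x, hx, rfl⟩ : ∃ x ∈ e.target, e.symm x = p := ⟨e p, e.map_source hp, e.left_inv hp⟩
  rw [e.right_inv hx, ← inner_mfderiv_symm g, mfderiv_symm_vecInChart he hx,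
    mfderiv_symm_vecInChart he hx]

include he he'

/-- The metric and its Lie derivative transform by the same Jacobian, so both factors multiply the
same invertible matrix. -/
theorem conformalFactor_unique (hn : 0 < n) (g : PseudoRiemannianMetric n M)
    {ξ : ∀ p : M, TangentSpace (𝓡 n) p}
    (hξ : ∀ e ∈ IsManifold.maximalAtlas (𝓡 n) ∞ M, ∀ k,
      ContDiffOn ℝ ∞ (fun y => vecInChart e (e.symm y) (ξ (e.symm y)) k) e.target)
    {x : Coord n} (hx : x ∈ e.target) (hx' : e.symm x ∈ e'.source) {c c' : ℝ}
    (hc : ∀ i j, lieDerivMetric (g.inChart e) (fun y => vecInChart e (e.symm y) (ξ (e.symm y))) x i j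
      = 2 * c * g.inChart e x i j)
    (hc' : ∀ i j, lieDerivMetric (g.inChart e')
      (fun y => vecInChart e' (e'.symm y) (ξ (e'.symm y))) (e' (e.symm x)) i j
      = 2 * c' * g.inChart e' (e' (e.symm x)) i j) : c = c' := by
  have hO : IsOpen (e.target ∩ e.symm ⁻¹' e'.source) := e.symm.isOpen_inter_preimage e'.open_source
  have hφ := contDiffOn_chart_change he he'
  have hl := isLocalMetric_inChart he g
  have hl' := isLocalMetric_inChart he' g
  set φ : Coord n → Coord n := fun y => e' (e.symm y) with hφdef
  have hy' : φ x ∈ e'.target := e'.map_source hx'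
  have hG : ∀ y ∈ e.target ∩ e.symm ⁻¹' e'.source, g.inChart e y
      = (jacobian φ y).transpose * g.inChart e' (φ y) * jacobian φ y := fun y hy => by
    have hd : DifferentiableAt ℝ φ y :=
      (hφ.differentiableOn (by simp)).differentiableAt (hO.mem_nhds hy)
    have hJ : ∀ a i, vecInChart e' (e.symm y) (chartVec e y i) a = jacobian φ y a i := fun a i => by
      rw [chartVec, ← fderiv_chart_change he he' hy.1 hy.2, ← fderiv_coord_apply hd]
      rfl
    ext i j
    have h1 : g.inChart e y i j = g.inner (e.symm y) (chartVec e y i) (chartVec e y j) := rfl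
    rw [h1, inner_eq_sum_vecInChart he' g hy.2]
    simp only [hJ, Matrix.mul_apply, Matrix.transpose_apply, Finset.sum_mul]
    rw [Finset.sum_comm]
    exact Finset.sum_congr rfl fun a _ => Finset.sum_congr rfl fun b _ => by ring
  have hζ : ∀ y ∈ e.target ∩ e.symm ⁻¹' e'.source,
      (fun y => vecInChart e' (e'.symm y) (ξ (e'.symm y))) (φ y)
        = fderiv ℝ φ y ((fun y => vecInChart e (e.symm y) (ξ (e.symm y))) y) := fun y hy => by
    rw [fderiv_chart_change he he' hy.1 hy.2]
    simp only
    rw [mfderiv_symm_vecInChart he hy.1]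
    exact congrArg (fun p => vecInChart e' p (ξ p)) (e'.left_inv hy.2)
  have key := lieDerivMetric_transform hO hφ ⟨hx, hx'⟩ hG hζ
    (fun i j => (hl'.smooth i j).diffAt hl'.isOpen hy')
    (fun k => (hξ e he k).diffAt hl.isOpen hx) (fun k => (hξ e' he' k).diffAt hl'.isOpen hy')
  have e1 : Matrix.of (lieDerivMetric (g.inChart e)
      (fun y => vecInChart e (e.symm y) (ξ (e.symm y))) x) = (2 * c) • g.inChart e x := by
    ext i j; exact hc i j
  have e2 : Matrix.of (lieDerivMetric (g.inChart e')
      (fun y => vecInChart e' (e'.symm y) (ξ (e'.symm y))) (φ x))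
      = (2 * c') • g.inChart e' (φ x) := by
    ext i j; exact hc' i j
  rw [e1, e2, Matrix.mul_smul, Matrix.smul_mul, ← hG x ⟨hx, hx'⟩] at key
  -- After multiplication by the inverse metric, any diagonal entry compares the factors; `0 < n`
  -- provides one.
  have key2 := congrArg (fun A => (A * (g.inChart e x)⁻¹) ⟨0, hn⟩ ⟨0, hn⟩) key
  simp only [Matrix.smul_mul, hl.mul_inv hx, Matrix.smul_apply, Matrix.one_apply_eq, smul_eq_mul,
    mul_one] at key2
  linarith

end ChartChange

theorem exists_global_conformalFactor (hn : 0 < n) (g : PseudoRiemannianMetric n M)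
    {ξ : ∀ p : M, TangentSpace (𝓡 n) p}
    (hξ : ∀ e ∈ IsManifold.maximalAtlas (𝓡 n) ∞ M, ∀ k,
      ContDiffOn ℝ ∞ (fun y => vecInChart e (e.symm y) (ξ (e.symm y)) k) e.target)
    (hex : ∀ e ∈ IsManifold.maximalAtlas (𝓡 n) ∞ M, ∃ ψ : Coord n → ℝ, ContDiffOn ℝ ∞ ψ e.target ∧
      ∀ x ∈ e.target, ∀ i j,
        lieDerivMetric (g.inChart e) (fun y => vecInChart e (e.symm y) (ξ (e.symm y))) x i j
          = 2 * ψ x * g.inChart e x i j) :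
    ∃ ψ : M → ℝ, ContMDiff (𝓡 n) 𝓘(ℝ, ℝ) ∞ ψ ∧
      ∀ e ∈ IsManifold.maximalAtlas (𝓡 n) ∞ M, ∀ x ∈ e.target, ∀ i j,
        lieDerivMetric (g.inChart e) (fun y => vecInChart e (e.symm y) (ξ (e.symm y))) x i j
          = 2 * ψ (e.symm x) * g.inChart e x i j := by
  choose! Ψ hΨ hL using hex
  have hat : ∀ p : M, chartAt (Coord n) p ∈ IsManifold.maximalAtlas (𝓡 n) ∞ M := fun p =>
    IsManifold.chart_mem_maximalAtlas p
  -- Reading the factor at p in the preferred chart of p agrees with reading it in any chart. This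
  -- gives both smoothness and the equation in all charts.
  have hψ : ∀ e ∈ IsManifold.maximalAtlas (𝓡 n) ∞ M, ∀ p ∈ e.source,
      Ψ (chartAt (Coord n) p) (chartAt (Coord n) p p) = Ψ e (e p) := fun e he p hp => by
    have h1 := conformalFactor_unique (e' := chartAt (Coord n) p) he (hat p) hn g hξ
      (e.map_source hp) (by rw [e.left_inv hp]; exact mem_chart_source _ p)
      (hL e he _ (e.map_source hp)) (hL _ (hat p) _ (by
        rw [e.left_inv hp]; exact mem_chart_target _ p))
    rw [e.left_inv hp] at h1
    exact h1.symm
  refine ⟨fun p => Ψ (chartAt (Coord n) p) (chartAt (Coord n) p p), fun p => ?_,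
    fun e he x hx => ?_⟩
  · have h1 : ContMDiffOn (𝓡 n) 𝓘(ℝ, ℝ) ∞
        (fun q => Ψ (chartAt (Coord n) p) (chartAt (Coord n) p q)) (chartAt (Coord n) p).source :=
      (hΨ _ (hat p)).contMDiffOn.comp (contMDiffOn_of_mem_maximalAtlas (hat p))
        fun q hq => (chartAt (Coord n) p).map_source hq
    have hs := (chartAt (Coord n) p).open_source.mem_nhds (mem_chart_source _ p)
    refine (h1.contMDiffAt hs).congr_of_eventuallyEq ?_
    filter_upwards [hs] with q hq using hψ _ (hat p) q hq
  · simp only [hψ e he _ (e.map_target hx), e.right_inv hx]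
    exact hL e he x hx

/-! ### Functions with vanishing partial derivatives -/

/-- Chart targets need not be convex, so constancy is first shown on coordinate balls and then
spread by connectedness. -/
theorem eq_of_pderiv_eq_zero [PreconnectedSpace M] {f : M → ℝ}
    (hf : ContMDiff (𝓡 n) 𝓘(ℝ, ℝ) ∞ f)
    (h0 : ∀ e ∈ IsManifold.maximalAtlas (𝓡 n) ∞ M, ∀ x ∈ e.target, ∀ j,
      pderiv j (fun y => f (e.symm y)) x = 0) (p q : M) : f p = f q := by
  have hloc : IsLocallyConstant f := by
    rw [IsLocallyConstant.iff_eventually_eq]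
    intro p
    set e := chartAt (Coord n) p with he_def
    have he : e ∈ IsManifold.maximalAtlas (𝓡 n) ∞ M := IsManifold.chart_mem_maximalAtlas p
    obtain ⟨r, hr, hball⟩ := Metric.isOpen_iff.1 e.open_target (e p) (mem_chart_target _ p)
    have hd : DifferentiableOn ℝ (fun y => f (e.symm y)) (Metric.ball (e p) r) := fun y hy =>
      ((contDiffOn_comp_symm he hf).diffAt e.open_target (hball hy)).differentiableWithinAt
    have hconst : ∀ y ∈ Metric.ball (e p) r, f (e.symm y) = f (e.symm (e p)) := fun y hy => by
      refine (convex_ball (e p) r).is_const_of_fderivWithin_eq_zero hd (fun z hz => ?_) hy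
        (Metric.mem_ball_self hr)
      rw [fderivWithin_of_isOpen Metric.isOpen_ball hz]
      ext v
      rw [fderiv_eq_sum_pderiv]
      simp [h0 e he z (hball hz)]
    have hp := mem_chart_source (Coord n) p
    have hc : ContinuousAt e p := e.continuousAt hp
    filter_upwards [e.open_source.mem_nhds hp, hc (Metric.ball_mem_nhds (e p) hr)] with q hq hqb
    have := hconst (e q) hqb
    rwa [e.left_inv hq, e.left_inv hp] at this
  exact hloc.apply_eq_of_preconnectedSpace p q

/-- The operator has no zeroth order term, so proportional gradients are enough; additive constants
do not matter. -/
theorem laplace_of_pderiv_eq {U : Set (Coord n)} (hU : IsOpen U)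
    (G : Coord n → Matrix (Fin n) (Fin n) ℝ) {f a : Coord n → ℝ} {c : ℝ}
    (hf : ContDiffOn ℝ ∞ f U) (h : ∀ y ∈ U, ∀ j, pderiv j a y = c * pderiv j f y) {x : Coord n}
    (hx : x ∈ U) : laplace G a x = c * laplace G f x := by
  have h2 : ∀ i j, pderiv j (pderiv i a) x = c * pderiv j (pderiv i f) x := fun i j => by
    rw [pderiv_congr hU (fun y hy => h y hy i) hx]
    exact ((((contDiffOn_pderiv hU hf i).diffAt hU hx).hasDirDeriv _).const_mul c).eq
  rw [laplace_eq, laplace_eq, mul_sub]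
  simp only [h2, h x hx, Finset.mul_sum]
  congr 1
  · exact Finset.sum_congr rfl fun i _ => Finset.sum_congr rfl fun j _ => by ring
  · exact Finset.sum_congr rfl fun i _ => by ring

/-! ### The Lie point symmetries of the Klein-Gordon equation -/

/-- `X` has the form `ξ^i(x) ∂_i + (c ψ(x) u + a₀ u + b(x)) ∂_u` with `ξ` a conformal Killing
vector field with conformal factor `ψ` that satisfies the potential condition, and `b` a solution. -/
def HasSymmetryForm (g : PseudoRiemannianMetric n M) (V : M → ℝ) (X : PointVectorField n M)
    (c : ℝ) : Prop :=
  ∃ (ξ : ∀ p : M, TangentSpace (𝓡 n) p) (ψ : M → ℝ) (a₀ : ℝ) (b : M → ℝ),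
    IsConformalKilling g ξ ψ ∧ IsSolution g V b ∧ PotentialCondition g V ξ ψ c ∧
    (∀ (p : M) (u : ℝ), X.ξ p u = ξ p) ∧
    (∀ (p : M) (u : ℝ), X.η p u = c * ψ p * u + a₀ * u + b p)

theorem IsLieSymmetry.hasSymmetryForm [ConnectedSpace M] (hn : 2 ≤ n)
    {g : PseudoRiemannianMetric n M} {V : M → ℝ} (hV : ContMDiff (𝓡 n) 𝓘(ℝ, ℝ) ∞ V)
    {X : PointVectorField n M} (hX : IsLieSymmetry g V X) :
    HasSymmetryForm g V X ((2 - (n : ℝ)) / 2) := by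
  have hS : ∀ e ∈ IsManifold.maximalAtlas (𝓡 n) ∞ M, ∀ x ∈ e.target, ∀ (u : ℝ) (p : Fin n → ℝ)
      (q : Fin n → Fin n → ℝ), (∀ i j, q i j = q j i) →
      kleinGordonJet (g.inChart e) (fun y => V (e.symm y)) (x, u, p, q) = 0 →
      prolongedDeriv (fun z => vecInChart e (e.symm z.1) (X.ξ (e.symm z.1) z.2))
        (fun z => X.η (e.symm z.1) z.2)
        (kleinGordonJet (g.inChart e) (fun y => V (e.symm y))) (x, u, p, q) = 0 := by
    intro e he x hx u p q hq h0
    obtain ⟨μ, hμ⟩ := hX e he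
    rw [hμ x hx u p q hq, h0, mul_zero]
  have hu : ∀ e ∈ IsManifold.maximalAtlas (𝓡 n) ∞ M, ∀ x ∈ e.target, ∀ u,
      vecInChart e (e.symm x) (X.ξ (e.symm x) u) = vecInChart e (e.symm x) (X.ξ (e.symm x) 0) := by
    intro e he x hx u
    ext k
    exact eq_of_du_eq_zero e.open_target (X.contDiffOn_ξ he k) hx
      (fun t => du_field_eq_zero (isLocalMetric_inChart he g) (contDiffOn_comp_symm he hV)
        (X.contDiffOn_ξ he) (X.contDiffOn_η he) hn (hS e he) hx t k) u
  have hξ : ∀ p u, X.ξ p u = X.ξ p 0 := fun p u => by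
    have he : chartAt (Coord n) p ∈ IsManifold.maximalAtlas (𝓡 n) ∞ M :=
      IsManifold.chart_mem_maximalAtlas p
    have h1 := hu _ he _ (mem_chart_target _ p) u
    rw [(chartAt (Coord n) p).left_inv (mem_chart_source _ p)] at h1
    exact (mdifferentiable_of_mem_maximalAtlas he).mfderiv_injective (mem_chart_source _ p) h1
  -- Writing the slope as a difference of two values of η makes its global smoothness immediate.
  have hη : ∀ p u, X.η p u = (X.η p 1 - X.η p 0) * u + X.η p 0 := fun p u => by
    have he : chartAt (Coord n) p ∈ IsManifold.maximalAtlas (𝓡 n) ∞ M :=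
      IsManifold.chart_mem_maximalAtlas p
    have h1 := eq_affine_of_du_du_eq_zero (chartAt (Coord n) p).open_target (X.contDiffOn_η he)
      (mem_chart_target _ p) (fun t => du_du_eq_zero (isLocalMetric_inChart he g)
        (contDiffOn_comp_symm he hV) (X.contDiffOn_ξ he) (X.contDiffOn_η he) hn (hS _ he)
        (mem_chart_target _ p) t)
    simp only [(chartAt (Coord n) p).left_inv (mem_chart_source _ p)] at h1
    rw [h1 u, h1 1]; ring
  have hslice : ∀ u : ℝ, ContMDiff (𝓡 n) ((𝓡 n).prod 𝓘(ℝ, ℝ)) ∞ (fun p : M => (p, u)) :=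
    fun u => contMDiff_id.prodMk contMDiff_const
  have hb : ContMDiff (𝓡 n) 𝓘(ℝ, ℝ) ∞ (fun p => X.η p 0) := X.smooth_η.comp (hslice 0)
  have ha : ContMDiff (𝓡 n) 𝓘(ℝ, ℝ) ∞ (fun p => X.η p 1 - X.η p 0) :=
    (X.smooth_η.comp (hslice 1)).sub hb
  obtain ⟨ψ, hψ, hL⟩ := exists_global_conformalFactor (ξ := fun p => X.ξ p 0) (by omega) g
    (fun e he k => (X.contDiffOn_ξ he k).comp (contDiffOn_id.prodMk contDiffOn_const)
      fun y hy => ⟨hy, Set.mem_univ _⟩)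
    (fun e he => exists_conformalFactor (isLocalMetric_inChart he g) (contDiffOn_comp_symm he hV)
      (X.contDiffOn_ξ he) (X.contDiffOn_η he) hn (hS e he))
  have hdet := fun e (he : e ∈ IsManifold.maximalAtlas (𝓡 n) ∞ M) x (hx : x ∈ e.target) =>
    determining_equations (isLocalMetric_inChart he g) (contDiffOn_comp_symm he hV)
      (X.contDiffOn_ξ he) (X.contDiffOn_η he) hn (hS e he) (hu e he)
      (fun x _ u => hη (e.symm x) u) (contDiffOn_comp_symm he ha) (contDiffOn_comp_symm he hb)
      (contDiffOn_comp_symm he hψ) (hL e he) hx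
  have hpd : ∀ e ∈ IsManifold.maximalAtlas (𝓡 n) ∞ M, ∀ x ∈ e.target, ∀ j,
      pderiv j (fun y => X.η (e.symm y) 1 - X.η (e.symm y) 0) x
        = (2 - (n : ℝ)) / 2 * pderiv j (fun y => ψ (e.symm y)) x := fun e he x hx j => by
    have := (hdet e he x hx).1 j
    linarith
  -- The function a - (2-n)/2 ψ has zero gradient; its constant value becomes a₀.
  have hconst := eq_of_pderiv_eq_zero
    (f := fun p => (X.η p 1 - X.η p 0) - (2 - (n : ℝ)) / 2 * ψ p)
    (ha.sub (contMDiff_const.mul hψ)) fun e he x hx j => by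
      have h1 := (((contDiffOn_comp_symm he ha).diffAt e.open_target hx).hasDirDeriv
        (coordVec j)).sub ((((contDiffOn_comp_symm he hψ).diffAt e.open_target hx).hasDirDeriv
        (coordVec j)).const_mul ((2 - (n : ℝ)) / 2))
      exact h1.eq.trans (sub_eq_zero.2 (hpd e he x hx j))
  obtain ⟨p₀⟩ : Nonempty M := inferInstance
  refine ⟨fun p => X.ξ p 0, ψ, (X.η p₀ 1 - X.η p₀ 0) - (2 - (n : ℝ)) / 2 * ψ p₀,
    fun p => X.η p 0, ⟨X.smooth_ξ.comp (hslice 0), hψ, hL⟩, ⟨hb, fun e he x hx =>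
    (hdet e he x hx).2.2⟩, fun e he x hx => ?_, hξ, fun p u => ?_⟩
  · have h1 := (hdet e he x hx).2.1
    rw [laplace_of_pderiv_eq e.open_target _ (contDiffOn_comp_symm he hψ) (hpd e he) hx] at h1
    linarith
  · rw [hη p u, hconst p₀ p]; ring

theorem HasSymmetryForm.isLieSymmetry {g : PseudoRiemannianMetric n M} {V : M → ℝ}
    (hV : ContMDiff (𝓡 n) 𝓘(ℝ, ℝ) ∞ V) {X : PointVectorField n M}
    (hX : HasSymmetryForm g V X ((2 - (n : ℝ)) / 2)) : IsLieSymmetry g V X := by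
  obtain ⟨ξ, ψ, a₀, b, ⟨-, hψ, hL⟩, ⟨hb, hsol⟩, hpot, hξ, hη⟩ := hX
  intro e he
  -- The multiplier is a - 2ψ, with a = (2-n)/2 ψ + a₀.
  refine ⟨fun z => ((2 - (n : ℝ)) / 2 * ψ (e.symm z.1) + a₀) - 2 * ψ (e.symm z.1),
    fun x hx u p q hq => ?_⟩
  have hψe := contDiffOn_comp_symm he hψ
  have hpd : ∀ y ∈ e.target, ∀ j,
      pderiv j (fun y => (2 - (n : ℝ)) / 2 * ψ (e.symm y) + a₀) y
        = (2 - (n : ℝ)) / 2 * pderiv j (fun y => ψ (e.symm y)) y := fun y hy j => by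
    rw [pderiv, fderiv_add_const]
    exact (((hψe.diffAt e.open_target hy).hasDirDeriv _).const_mul _).eq
  rw [prolongedDeriv_of_conformalKilling (isLocalMetric_inChart he g) (contDiffOn_comp_symm he hV)
    (X.contDiffOn_ξ he) (X.contDiffOn_η he)
    (ζ := fun y => vecInChart e (e.symm y) (ξ (e.symm y)))
    (a := fun y => (2 - (n : ℝ)) / 2 * ψ (e.symm y) + a₀) (b := fun y => b (e.symm y))
    (fun y _ t => by simp only [hξ]) (fun y _ t => by simp only [hη]; ring)
    ((contDiffOn_const.mul hψe).add contDiffOn_const) (contDiffOn_comp_symm he hb) hψe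
    (hL e he) hx u p hq,
    laplace_of_pderiv_eq e.open_target _ hψe hpd hx, hsol e he x hx]
  have h1 := hpot e he x hx
  have h2 : ∀ j, 2 * pderiv j (fun y => (2 - (n : ℝ)) / 2 * ψ (e.symm y) + a₀) x
      - (2 - (n : ℝ)) * pderiv j (fun y => ψ (e.symm y)) x = 0 := fun j => by
    rw [hpd x hx]; ring
  simp only [h2, mul_zero, Finset.sum_const_zero, zero_mul, add_zero, sub_self]
  linear_combination (-u) * h1

theorem isLieSymmetry_iff_hasSymmetryForm [ConnectedSpace M] (hn : 2 ≤ n)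
    (g : PseudoRiemannianMetric n M) {V : M → ℝ} (hV : ContMDiff (𝓡 n) 𝓘(ℝ, ℝ) ∞ V)
    (X : PointVectorField n M) :
    IsLieSymmetry g V X ↔ HasSymmetryForm g V X ((2 - (n : ℝ)) / 2) :=
  ⟨fun h => h.hasSymmetryForm hn hV, fun h => h.isLieSymmetry hV⟩

end

end KleinGordon

end

/-! ### The cases n > 2 and n = 2. -/

theorem proposition2 (n : ℕ) (M : Type*) [TopologicalSpace M] [ConnectedSpace M]
    [ChartedSpace (EuclideanSpace ℝ (Fin n)) M] [IsManifold (𝓡 n) ∞ M]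
    (g : KleinGordon.PseudoRiemannianMetric n M)
    (V : M → ℝ) (hV : ContMDiff (𝓡 n) 𝓘(ℝ, ℝ) ∞ V)
    (X : KleinGordon.PointVectorField n M) :
    (2 < n →
      (KleinGordon.IsLieSymmetry g V X ↔
        ∃ (ξ : ∀ p : M, TangentSpace (𝓡 n) p) (ψ : M → ℝ) (a₀ : ℝ) (b : M → ℝ),
          KleinGordon.IsConformalKilling g ξ ψ ∧
          KleinGordon.IsSolution g V b ∧
          KleinGordon.PotentialCondition g V ξ ψ ((2 - (n : ℝ)) / 2) ∧
          (∀ (p : M) (u : ℝ), X.ξ p u = ξ p) ∧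
          (∀ (p : M) (u : ℝ), X.η p u = (2 - (n : ℝ)) / 2 * ψ p * u + a₀ * u + b p))) ∧
    (n = 2 →
      (KleinGordon.IsLieSymmetry g V X ↔
        ∃ (ξ : ∀ p : M, TangentSpace (𝓡 n) p) (ψ : M → ℝ) (a₀ : ℝ) (b : M → ℝ),
          KleinGordon.IsConformalKilling g ξ ψ ∧
          KleinGordon.IsSolution g V b ∧
          KleinGordon.PotentialCondition g V ξ ψ 0 ∧
          (∀ (p : M) (u : ℝ), X.ξ p u = ξ p) ∧
          (∀ (p : M) (u : ℝ), X.η p u = a₀ * u + b p))) := by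
  refine ⟨fun hn => KleinGordon.isLieSymmetry_iff_hasSymmetryForm hn.le g hV X, fun hn => ?_⟩
  rw [KleinGordon.isLieSymmetry_iff_hasSymmetryForm hn.ge g hV X]
  -- In dimension two the ψ-term of η and the Δψ-term of the potential condition drop out together.
  have h0 : (2 - (n : ℝ)) / 2 = 0 := by rw [hn]; norm_num
  simp only [KleinGordon.HasSymmetryForm, h0, zero_mul, zero_add]
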